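/- Let $a_1,\dots,a_n$ be nonzero integers and let $D=P(a_1,\dots,a_n)$ be the standard pretzel diagram: $n$ vertical columns of crossings placed side by side, the $l$-th column consisting of $|a_l|$ crossings stacked vertically (a column of half twists of two strands), where the right ends of each column are joined at the top and at the bottom to the left ends of the next column, in cyclic order. The sign convention is that, when both strands of the $l$-th column are directed upwards, its crossings are positive if $a_l>0$ and negative if $a_l<0$. Orient $D$ arbitrarily, and let $L$ be the resulting oriented pretzel link. Suppose that 1. $a_l\neq 1$ for every $l\in\{1,\dots,n\}$; 2. there is an $i\in\{1,\dots,n\}$ with $a_i\ge 3$; 3. there are $j,k\in\{1,\dots,n\}$ with $j\ne k$ and $a_j,a_k<0$. Then the Khovanov homology of $L$ with integer coefficients contains at least $$\prod_{l\,:\,a_l>0}\left\lfloor\frac{a_l}{2}\right\rfloor-1$$ different torsion subgroups $\mathbb{Z}_2$; that is, there are at least that many different triples $(h,q,H)$ in which $h,q$ are integers and $H$ is a subgroup of $Kh^{h,q}(L)$ with $H\cong\mathbb{Z}/2\mathbb{Z}$. Here $Kh^{h,q}(L)$ is the homology of the Khovanov complex of $D$ over $\mathbb{Z}$ in homological degree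 $i=h+n_-$ and quantum degree $j=q-n_++2n_-$, where $n_+$ and $n_-$ are the numbers of positive and negative crossings of $D$, with respect to any numbering of the crossings. The complex is generated by the enhanced states $s$ of $D$ (a label $A$ or $B$ at each crossing and a sign $\pm$ on each circle of the resulting smoothing), where $i(s)$ is the number of $B$-labels and $j(s)$ is $i(s)$ plus the number of circles with sign $+$ minus the number of circles with sign $-$. Its differential is $d(s)=\sum_t(-1)^{k(s,t)}t$, where $t$ runs over the enhanced states with $j(t)=j(s)$ that have the same labels as $s$ except at one crossing $x$, where $s$ has $A$ and $t$ has $B$, and the same signs as $s$ on the circles common to both smoothings; $k(s,t)$ is the number of crossings before $x$ at which $s$ has the label $B$. -/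

import Mathlib

/-- The four ends of a crossing. After a planar isotopy every crossing is drawn with its two strands
along the diagonals, so that its ends point to the north-west, north-east, south-west and
south-east. -/
inductive Corner
  | nw
  | ne
  | sw
  | se
  deriving DecidableEq

instance : Fintype Corner :=
  ⟨{Corner.nw, Corner.ne, Corner.sw, Corner.se}, fun c => by cases c <;> decide⟩

namespace Corner

/-- The other end on the same side (left or right). -/
def vert : Corner → Corner
  | nw => sw
  | sw => nw
  | ne => se
  | se => ne

/-- The other end at the same height (top or bottom). -/
def horiz : Corner → Corner
  | nw => ne
  | ne => nw
  | sw => se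
  | se => sw

/-- The other end of the same strand. -/
def opp : Corner → Corner
  | nw => se
  | se => nw
  | ne => sw
  | sw => ne

end Corner

/-- The combinatorial data of an unoriented link diagram with crossing set `X` (without components
that meet no crossing). An *end* is a pair `(x, c)` of a crossing and one of its four corners.
The underlying four-valent plane graph is recorded by the involution `glue`, which exchanges the two
ends of every edge. At the crossing `x` the over-strand joins `sw` to `ne` if `overRising x` is
`true`, and it joins `nw` to `se` if `overRising x` is `false`. -/
structure LinkDiagram (X : Type) where
  overRising : X → Bool
  glue : X × Corner → X × Corner
  glue_glue : ∀ p, glue (glue p) = p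
  glue_ne : ∀ p, glue p ≠ p

/-- The two labels of a Kauffman state. -/
inductive Label
  | A
  | B
  deriving DecidableEq

instance : Fintype Label := ⟨{Label.A, Label.B}, fun c => by cases c <;> decide⟩

namespace LinkDiagram

variable {X : Type}

/-- The smoothing of the crossings of `D` given by a Kauffman state `s`, as the involution that
exchanges the two ends of each of the arcs which replace the crossings. The `A`-smoothing opens the
two regions that are swept when the over-strand is rotated counterclockwise; if the over-strand
joins `sw` to `ne` these are the top and the bottom region, so that the two arcs of the
`A`-smoothing are then the left one (`nw`-`sw`) and the right one (`ne`-`se`). -/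
def smooth (D : LinkDiagram X) (s : X → Label) (p : X × Corner) : X × Corner :=
  (p.1, if s p.1 = Label.A ↔ D.overRising p.1 = true then p.2.vert else p.2.horiz)

/-- Two ends are equivalent if they lie on the same circle of `sD`: the circles are traced by going
alternately along the edges of the diagram and along the smoothing arcs. -/
def circleSetoid (D : LinkDiagram X) (s : X → Label) : Setoid (X × Corner) :=
  Relation.EqvGen.setoid fun p q => q = D.glue p ∨ q = D.smooth s p

/-- The circles of `sD`. -/
abbrev Circle (D : LinkDiagram X) (s : X → Label) : Type := Quotient (D.circleSetoid s)

/-- The circle of `sD` through an end `p`. -/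
def circleThrough (D : LinkDiagram X) (s : X → Label) (p : X × Corner) : D.Circle s :=
  Quotient.mk _ p

/-- An enhanced state: a Kauffman state `s` and a sign for each circle of `sD`. -/
abbrev EnhancedState (D : LinkDiagram X) : Type :=
  Σ s : X → Label, (D.Circle s → ℤˣ)

/-- The homological degree `i(s)`: the number of `B`-labels. -/
noncomputable def homDegree (D : LinkDiagram X) (s : D.EnhancedState) : ℤ :=
  (Nat.card {x : X // s.1 x = Label.B} : ℤ)

/-- `θ(s)`: the number of circles with sign `+` minus the number of circles with sign `-`. -/
noncomputable def theta (D : LinkDiagram X) (s : D.EnhancedState) : ℤ :=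
  (Nat.card {C : D.Circle s.1 // s.2 C = 1} : ℤ) - (Nat.card {C : D.Circle s.1 // s.2 C = -1} : ℤ)

/-- The quantum degree `j(s) = i(s) + θ(s)`. -/
noncomputable def quantumDegree (D : LinkDiagram X) (s : D.EnhancedState) : ℤ :=
  D.homDegree s + D.theta s

/-- `t` is adjacent to `s` with change crossing `x`: the labels agree except at `x`, where `s` has
the label `A` and `t` the label `B` (hence `i(t) = i(s) + 1`), the quantum degrees agree, and the
signs of `s` and `t` agree on their common circles. A circle of `sD` and a circle of `tD` are the
same circle if they consist of the same ends. -/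
def AdjacentAt (D : LinkDiagram X) (x : X) (s t : D.EnhancedState) : Prop :=
  s.1 x = Label.A ∧ t.1 x = Label.B ∧ (∀ y, y ≠ x → t.1 y = s.1 y) ∧
    D.quantumDegree t = D.quantumDegree s ∧
    ∀ p, (∀ q, D.circleSetoid s.1 p q ↔ D.circleSetoid t.1 p q) →
      t.2 (D.circleThrough t.1 p) = s.2 (D.circleThrough s.1 p)

open Classical in
/-- The incidence number `i(s, t)` with respect to a numbering `num` of the crossings: it is
`(-1) ^ k` if `t` is adjacent to `s` with change crossing `x` and `k` is the number of crossings
before `x` at which `s` has the label `B`, and it is `0` if `t` is not adjacent to `s`. (There is at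
most one change crossing, so the sum has at most one nonzero term.) -/
noncomputable def incidence [Fintype X] (D : LinkDiagram X) (num : X ↪ ℕ)
    (s t : D.EnhancedState) : ℤ :=
  ∑ x : X, if D.AdjacentAt x s t then
    (-1) ^ Nat.card {y : X // num y < num x ∧ s.1 y = Label.B} else 0

/-- The enhanced states of homological degree `i` and quantum degree `j`. -/
abbrev StatesOfDegree (D : LinkDiagram X) (i j : ℤ) : Type :=
  {s : D.EnhancedState // D.homDegree s = i ∧ D.quantumDegree s = j}

/-- The chain module `C^{i,j}(D)` with integral coefficients: the free abelian group on the
enhanced states of degrees `i` and `j`. -/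
abbrev Chain (D : LinkDiagram X) (i j : ℤ) : Type := D.StatesOfDegree i j →₀ ℤ

/-- The map `C^{i,j}(D) → C^{i',j}(D)` with `s ↦ ∑ t, i(s, t) t`. It is the Khovanov differential
for `i' = i + 1` (and zero for all other `i'`). -/
noncomputable def differential [Fintype X] (D : LinkDiagram X) (num : X ↪ ℕ) (i i' j : ℤ) :
    D.Chain i j →ₗ[ℤ] D.Chain i' j :=
  Finsupp.linearCombination ℤ fun s : D.StatesOfDegree i j =>
    Finsupp.equivFunOnFinite.symm fun t : D.StatesOfDegree i' j => D.incidence num s.1 t.1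

/-- The Khovanov homology of the diagram in homological degree `i` and quantum degree `j`, integral
coefficients: the kernel of `C^{i,j} → C^{i+1,j}` modulo the image of `C^{i-1,j} → C^{i,j}`. -/
abbrev DiagramHomology [Fintype X] (D : LinkDiagram X) (num : X ↪ ℕ) (i j : ℤ) : Type :=
  LinearMap.ker (D.differential num i (i + 1) j) ⧸
    (LinearMap.range (D.differential num (i - 1) i j)).submoduleOf
      (LinearMap.ker (D.differential num i (i + 1) j))

/-- An orientation of (the link given by) the diagram: `outgoing p` says whether the strand at the
end `p` is directed away from the crossing. A strand that leaves a crossing at one end enters it at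
the opposite end, and an edge leaves the crossing at one of its ends and enters at the other. -/
structure Orientation (D : LinkDiagram X) where
  outgoing : X × Corner → Bool
  outgoing_opp : ∀ x c, outgoing (x, c.opp) = !outgoing (x, c)
  outgoing_glue : ∀ p, outgoing (D.glue p) = !outgoing p

/-- A crossing is positive if the under-strand crosses the over-strand from right to left. If the
two strands are directed both upwards or both downwards this means that the over-strand joins
`sw` to `ne`; if they are directed both to the right or both to the left it means that the
over-strand joins `nw` to `se`. -/
def Orientation.IsPositive {D : LinkDiagram X} (o : D.Orientation) (x : X) : Prop :=
  o.outgoing (x, Corner.nw) = o.outgoing (x, Corner.ne) ↔ D.overRising x = true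

/-- The number `p` of positive crossings. -/
noncomputable def Orientation.positiveCount {D : LinkDiagram X} (o : D.Orientation) : ℤ :=
  (Nat.card {x : X // o.IsPositive x} : ℤ)

/-- The number `n` of negative crossings. -/
noncomputable def Orientation.negativeCount {D : LinkDiagram X} (o : D.Orientation) : ℤ :=
  (Nat.card {x : X // ¬ o.IsPositive x} : ℤ)

/-- The integral Khovanov homology `Kh^{h,q}(L)` of the oriented link `L` given by the diagram `D`
with the orientation `o`: the homology of the diagram in the degrees `i = h + n` and
`j = q - p + 2n`. -/
abbrev KhovanovHomology [Fintype X] (D : LinkDiagram X) (num : X ↪ ℕ) (o : D.Orientation)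
    (h q : ℤ) : Type :=
  D.DiagramHomology num (h + o.negativeCount) (q - o.positiveCount + 2 * o.negativeCount)

end LinkDiagram

/-- The crossings of the pretzel diagram `P(a_1, …, a_n)`: the column `l` has `|a_l|` crossings,
which are stacked vertically and numbered from top to bottom. -/
abbrev PretzelCrossing {n : ℕ} (a : Fin n → ℤ) : Type := Σ l : Fin n, Fin (a l).natAbs

namespace PretzelCrossing

variable {n : ℕ} {a : Fin n → ℤ}

/-- The first crossing of a column. -/
def top (ha : ∀ l, a l ≠ 0) (l : Fin n) : PretzelCrossing a :=
  ⟨l, 0, Int.natAbs_pos.mpr (ha l)⟩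

/-- The last crossing of a column. -/
def bottom (ha : ∀ l, a l ≠ 0) (l : Fin n) : PretzelCrossing a :=
  ⟨l, (a l).natAbs - 1, Nat.sub_lt (Int.natAbs_pos.mpr (ha l)) Nat.one_pos⟩

/-- The edges of the pretzel diagram. Within a column, the two lower ends of a crossing are joined
to the two upper ends of the next crossing. The upper (lower) right end of a column is joined to the
upper (lower) left end of the next column, in cyclic order. -/
def glue (ha : ∀ l, a l ≠ 0) : PretzelCrossing a × Corner → PretzelCrossing a × Corner
  | (⟨l, k⟩, Corner.nw) =>
      if k.val = 0 then (top ha ((finRotate n).symm l), Corner.ne)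
      else (⟨l, k.val - 1, by omega⟩, Corner.sw)
  | (⟨l, k⟩, Corner.ne) =>
      if k.val = 0 then (top ha (finRotate n l), Corner.nw)
      else (⟨l, k.val - 1, by omega⟩, Corner.se)
  | (⟨l, k⟩, Corner.sw) =>
      if h : k.val + 1 < (a l).natAbs then (⟨l, k.val + 1, h⟩, Corner.nw)
      else (bottom ha ((finRotate n).symm l), Corner.se)
  | (⟨l, k⟩, Corner.se) =>
      if h : k.val + 1 < (a l).natAbs then (⟨l, k.val + 1, h⟩, Corner.ne)
      else (bottom ha (finRotate n l), Corner.sw)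

theorem glue_top_nw (ha : ∀ l, a l ≠ 0) (l : Fin n) :
    glue ha (top ha l, Corner.nw) = (top ha ((finRotate n).symm l), Corner.ne) := rfl

theorem glue_top_ne (ha : ∀ l, a l ≠ 0) (l : Fin n) :
    glue ha (top ha l, Corner.ne) = (top ha (finRotate n l), Corner.nw) := rfl

theorem glue_bottom_sw (ha : ∀ l, a l ≠ 0) (l : Fin n) :
    glue ha (bottom ha l, Corner.sw) = (bottom ha ((finRotate n).symm l), Corner.se) := by
  have := Int.natAbs_pos.mpr (ha l)
  exact dif_neg (by simp only [not_lt]; omega)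

theorem glue_bottom_se (ha : ∀ l, a l ≠ 0) (l : Fin n) :
    glue ha (bottom ha l, Corner.se) = (bottom ha (finRotate n l), Corner.sw) := by
  have := Int.natAbs_pos.mpr (ha l)
  exact dif_neg (by simp only [not_lt]; omega)

theorem glue_glue (ha : ∀ l, a l ≠ 0) (p : PretzelCrossing a × Corner) :
    glue ha (glue ha p) = p := by
  obtain ⟨⟨l, k, hk⟩, c⟩ := p
  have htop : k = 0 → (⟨l, k, hk⟩ : PretzelCrossing a) = top ha l := by
    rintro rfl; rfl
  have hbot : ¬ k + 1 < (a l).natAbs → (⟨l, k, hk⟩ : PretzelCrossing a) = bottom ha l := by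
    intro h
    obtain rfl : k = (a l).natAbs - 1 := by omega
    rfl
  cases c
  · by_cases h0 : k = 0
    · rw [htop h0, glue_top_nw, glue_top_ne, Equiv.apply_symm_apply]
    · have : k - 1 + 1 = k := by omega
      simp [glue, h0, this, hk]
  · by_cases h0 : k = 0
    · rw [htop h0, glue_top_ne, glue_top_nw, Equiv.symm_apply_apply]
    · have : k - 1 + 1 = k := by omega
      simp [glue, h0, this, hk]
  · by_cases h0 : k + 1 < (a l).natAbs
    · simp [glue, h0]
    · rw [hbot h0, glue_bottom_sw, glue_bottom_se, Equiv.apply_symm_apply]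
  · by_cases h0 : k + 1 < (a l).natAbs
    · simp [glue, h0]
    · rw [hbot h0, glue_bottom_se, glue_bottom_sw, Equiv.symm_apply_apply]

theorem glue_ne (ha : ∀ l, a l ≠ 0) (p : PretzelCrossing a × Corner) : glue ha p ≠ p := by
  obtain ⟨⟨l, k, hk⟩, c⟩ := p
  intro h
  have h2 := congrArg Prod.snd h
  cases c <;> simp only [glue] at h2 <;> split_ifs at h2

end PretzelCrossing

/-- The standard pretzel diagram `P(a_1, …, a_n)`, with all entries nonzero: `n` vertical columns of
half twists, side by side, the column `l` with `|a_l|` crossings, where the over-strands run from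
`sw` to `ne` if `a_l > 0` and from `nw` to `se` if `a_l < 0`. -/
def pretzelDiagram {n : ℕ} (a : Fin n → ℤ) (ha : ∀ l, a l ≠ 0) :
    LinkDiagram (PretzelCrossing a) where
  overRising x := decide (0 < a x.1)
  glue := PretzelCrossing.glue ha
  glue_glue := PretzelCrossing.glue_glue ha
  glue_ne := PretzelCrossing.glue_ne ha

/-! Fix a number `T l` of `B`-labels for every column, such that negative columns are labelled by
`B` throughout and every positive column has at least one `B`. Changing a further `A` to `B` in a
positive column then always splits a circle, so the differential only involves comultiplications:
`+` goes to `(+-)` and `(-+)`, and `-` goes to `(--)`. Also, the upper left and the lower left end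
of each column lie on one circle, the outer circle of the column.

Consider the signed sum of all states with counts `T` and one prescribed rule for the negative
circles. At a target state, column `l` contributes an alternating sum over its `B`-crossings of two
terms, one for each of the circles at the crossing. Consecutive `B`-crossings share a circle, so the
sum telescopes (`sum_column`) and leaves the outer circle with the factor `1 + (-1) ^ T l`
(`differential_countChain`). An odd `T l` therefore contributes nothing, an even one contributes
twice a term, and a column full of `B` contributes nothing since it has no `A` left.

Let `T l` be odd or maximal in every positive column, and not maximal in some column `l₀`. The sum
`z` of the states whose only negative circle is the outer circle of `l₀` is a cycle. With one `B`
less in `l₀` and all circles positive, the differential is `2z` up to sign. That `z` is no boundary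
is seen by a functional modulo 2 (`oneMinus`): over one Kauffman state `S`, add the coefficients of
the states with exactly one negative circle. If the two arcs at each `B`-crossing of `S` lie on
different circles, boundaries hit these states in pairs, so the functional vanishes on them
(`oneMinus_differential`); on `z` it is odd. The separation needs `T l ≥ 2` in positive columns and
two negative columns.

Several `T` may give the same bidegree, but the functional belonging to `T'` vanishes on the cycle
of every other `T`, so the subgroups differ. A positive column allows the odd numbers from 3 up to
below `a l` and `a l` itself, which are `⌊a l / 2⌋` values; excluding the choice that is maximal
everywhere costs the `-1`. -/

namespace LinkDiagram

/-! ### Circles of a smoothing and the effect of changing one crossing -/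

variable {X : Type}

theorem circleThrough_eq_iff (D : LinkDiagram X) (s : X → Label) (p q : X × Corner) :
    D.circleThrough s p = D.circleThrough s q ↔ D.circleSetoid s p q :=
  ⟨Quotient.exact, fun h => Quotient.sound h⟩

theorem circleSetoid_glue (D : LinkDiagram X) (s : X → Label) (p : X × Corner) :
    D.circleSetoid s p (D.glue p) :=
  Relation.EqvGen.rel _ _ (Or.inl rfl)

theorem circleSetoid_smooth (D : LinkDiagram X) (s : X → Label) (p : X × Corner) :
    D.circleSetoid s p (D.smooth s p) :=
  Relation.EqvGen.rel _ _ (Or.inr rfl)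

theorem circleSetoid_le (D : LinkDiagram X) (s : X → Label) (r : Setoid (X × Corner))
    (hg : ∀ p, r p (D.glue p)) (hs : ∀ p, r p (D.smooth s p)) : D.circleSetoid s ≤ r := by
  refine Setoid.eqvGen_le ?_
  rintro p q (rfl | rfl)
  · exact hg p
  · exact hs p

theorem smooth_eq_vert_or_horiz (D : LinkDiagram X) (x : X) {s t : X → Label} (h : s x ≠ t x) :
    ((∀ c, D.smooth s (x, c) = (x, c.vert)) ∧ (∀ c, D.smooth t (x, c) = (x, c.horiz))) ∨
    ((∀ c, D.smooth s (x, c) = (x, c.horiz)) ∧ (∀ c, D.smooth t (x, c) = (x, c.vert))) := by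
  unfold smooth
  cases hs : s x <;> cases ht : t x <;> cases ho : D.overRising x <;> simp [hs, ht, ho] at h ⊢

theorem smooth_congr (D : LinkDiagram X) {s t : X → Label} {p : X × Corner}
    (h : s p.1 = t p.1) : D.smooth s p = D.smooth t p := by
  unfold smooth; rw [h]

theorem smooth_smooth (D : LinkDiagram X) (s : X → Label) (p : X × Corner) :
    D.smooth s (D.smooth s p) = p := by
  obtain ⟨x, c⟩ := p
  unfold smooth
  by_cases h : s x = Label.A ↔ D.overRising x = true
  · simp only [h]; cases c <;> simp [Corner.vert]
  · simp only [h]; cases c <;> simp [Corner.horiz]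

theorem smooth_ne (D : LinkDiagram X) (s : X → Label) (p : X × Corner) : D.smooth s p ≠ p := by
  obtain ⟨x, c⟩ := p
  unfold smooth
  by_cases h : s x = Label.A ↔ D.overRising x = true
  · simp only [h]; cases c <;> simp [Corner.vert]
  · simp only [h]; cases c <;> simp [Corner.horiz]

/-- A set of ends that is closed under the edges and under the smoothing arcs is a union of
circles. -/
theorem mem_iff_of_circleSetoid (D : LinkDiagram X) (s : X → Label) (K : X × Corner → Prop)
    (hg : ∀ p, K p → K (D.glue p)) (hs : ∀ p, K p → K (D.smooth s p)) {p q : X × Corner}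
    (h : D.circleSetoid s p q) : K p ↔ K q := by
  have := D.circleSetoid_le s (Setoid.ker K)
    (fun p => propext ⟨hg p, fun h => by simpa [D.glue_glue] using hg _ h⟩)
    (fun p => propext ⟨hs p, fun h => by simpa [D.smooth_smooth] using hs _ h⟩) h
  exact iff_of_eq this

/-- The two arcs at the crossing `x` lie on different circles of `sD`. (The ends `nw` and `se`
always belong to different arcs.) -/
def Separated (D : LinkDiagram X) (s : X → Label) (x : X) : Prop :=
  ¬ D.circleSetoid s (x, Corner.nw) (x, Corner.se)

theorem circleSetoid_corner (D : LinkDiagram X) (s : X → Label) (x : X) (c : Corner) :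
    D.circleSetoid s (x, Corner.nw) (x, c) ∨ D.circleSetoid s (x, Corner.se) (x, c) := by
  have h1 := D.circleSetoid_smooth s (x, Corner.nw)
  have h2 := D.circleSetoid_smooth s (x, Corner.se)
  have r1 := (D.circleSetoid s).refl (x, Corner.nw)
  have r2 := (D.circleSetoid s).refl (x, Corner.se)
  unfold smooth at h1 h2
  simp only at h1 h2
  split_ifs at h1 h2 <;> cases c <;> simp_all [Corner.vert, Corner.horiz]

/-- The four ends at `x` form two arcs. If a circle contained ends of both arcs, it would contain
`nw` and `se` as well. -/
theorem eq_or_eq_smooth_of_separated (D : LinkDiagram X) {s : X → Label} {x : X}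
    (h : D.Separated s x) {c c' : Corner} (hc : D.circleSetoid s (x, c) (x, c')) :
    c' = c ∨ (x, c') = D.smooth s (x, c) := by
  by_contra hcon
  apply h
  have h1 := D.circleSetoid_smooth s (x, Corner.nw)
  have h2 := D.circleSetoid_smooth s (x, Corner.se)
  have hc' := (D.circleSetoid s).symm hc
  have tr := @(D.circleSetoid s).trans
  have sy := @(D.circleSetoid s).symm
  unfold smooth at h1 h2 hcon
  simp only at h1 h2 hcon
  split_ifs at h1 h2 hcon <;> cases c <;> cases c' <;>
    simp [Corner.vert, Corner.horiz] at hcon h1 h2 <;>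
    first
    | exact hc
    | exact hc'
    | exact tr h1 hc
    | exact tr h1 hc'
    | exact tr hc (sy h2)
    | exact tr hc' (sy h2)
    | exact tr h1 (tr hc (sy h2))
    | exact tr h1 (tr hc' (sy h2))

/-- A finite set with a fixed point free involution has an even number of elements. -/
theorem card_eq_zero_of_involution {α : Type*} (K : Finset α) (f : α → α)
    (hK : ∀ p ∈ K, f p ∈ K) (hne : ∀ p, f p ≠ p) (hf : ∀ p, f (f p) = p) :
    (K.card : ZMod 2) = 0 := by
  have := Finset.sum_involution (s := K) (f := fun _ => (1 : ZMod 2)) (fun p _ => f p)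
    (fun _ _ => by decide) (fun p _ _ => hne p) hK (fun p _ => hf p)
  simpa using this

/-- If the two arcs at `x` lie on different circles of `tD`, then the ends of such an arc remain
connected when the smoothing of `x` is changed. -/
theorem circleSetoid_smooth_of_separated [Finite X] (D : LinkDiagram X) {s t : X → Label} {x : X}
    (hst : ∀ y, y ≠ x → t y = s y) (hx : D.Separated t x) (c : Corner) :
    D.circleSetoid s (x, c) (D.smooth t (x, c)) := by
  classical
  have := Fintype.ofFinite X
  -- `R` traces the circles with both arcs at `x` removed, so it is finer than both circle
  -- relations.
  set R : Setoid (X × Corner) :=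
    Relation.EqvGen.setoid fun p q => q = D.glue p ∨ (p.1 ≠ x ∧ q = D.smooth t p) with hR
  have hRs : R ≤ D.circleSetoid s := by
    refine Setoid.eqvGen_le ?_
    rintro p q (rfl | ⟨h, rfl⟩)
    · exact D.circleSetoid_glue s p
    · rw [D.smooth_congr (hst _ h)]; exact D.circleSetoid_smooth s p
  have hRt : R ≤ D.circleSetoid t := by
    refine Setoid.eqvGen_le ?_
    rintro p q (rfl | ⟨h, rfl⟩)
    · exact D.circleSetoid_glue t p
    · exact D.circleSetoid_smooth t p
  by_contra hcon
  have hcon' : ¬ R (x, c) (D.smooth t (x, c)) := fun h => hcon (hRs h)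
  set K : Finset (X × Corner) := Finset.univ.filter fun q => R (x, c) q with hK
  have hmem : ∀ q, q ∈ K ↔ R (x, c) q := by simp [hK]
  -- Parity: the class `K` is paired off by the edges. If it met `x` only in `(x, c)`, then `K`
  -- without this end would be paired off by the smoothing arcs, and `K` would be odd.
  have h1 : (K.card : ZMod 2) = 0 :=
    card_eq_zero_of_involution K D.glue
      (fun p hp => (hmem _).2 (R.trans ((hmem _).1 hp) (Relation.EqvGen.rel _ _ (Or.inl rfl))))
      D.glue_ne D.glue_glue
  have hmemx : (x, c) ∈ K := (hmem _).2 (R.refl _)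
  have honly : ∀ q ∈ K, q.1 = x → q = (x, c) := by
    rintro ⟨y, c'⟩ hq rfl
    rcases D.eq_or_eq_smooth_of_separated hx (hRt ((hmem _).1 hq)) with h | h
    · rw [h]
    · exact absurd (h ▸ (hmem _).1 hq) hcon'
  have h2 : ((K.erase (x, c)).card : ZMod 2) = 0 := by
    refine card_eq_zero_of_involution _ (D.smooth t) ?_ (D.smooth_ne t) (D.smooth_smooth t)
    intro p hp
    obtain ⟨hp1, hp2⟩ := Finset.mem_erase.1 hp
    have hpx : p.1 ≠ x := fun h => hp1 (honly p hp2 h)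
    refine Finset.mem_erase.2 ⟨fun h => hpx ?_, (hmem _).2 (R.trans ((hmem _).1 hp2)
      (Relation.EqvGen.rel _ _ (Or.inr ⟨hpx, rfl⟩)))⟩
    have := congrArg Prod.fst h
    exact this
  have h3 := Finset.card_erase_add_one hmemx
  rw [← h3] at h1
  push_cast at h1
  rw [h2] at h1
  exact absurd h1 (by decide)

/-- If the two arcs at `x` lie on different circles of `tD`, then all four ends at `x` lie on the
same circle after the smoothing of `x` is changed. -/
theorem circleSetoid_corner_of_separated [Finite X] (D : LinkDiagram X) {s t : X → Label} {x : X}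
    (hst : ∀ y, y ≠ x → t y = s y) (hne : s x ≠ t x) (hx : D.Separated t x) (c : Corner) :
    D.circleSetoid s (x, Corner.nw) (x, c) := by
  have h := D.circleSetoid_smooth_of_separated hst hx
  have h' := fun c => D.circleSetoid_smooth s (x, c)
  have tr := @(D.circleSetoid s).trans
  have sy := @(D.circleSetoid s).symm
  rcases D.smooth_eq_vert_or_horiz x hne with ⟨e1, e2⟩ | ⟨e1, e2⟩ <;>
    simp only [e1, e2] at h h'
  · have a1 := h Corner.nw
    have a2 := h' Corner.nw
    have a3 := h' Corner.ne
    cases c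
    · exact (D.circleSetoid s).refl _
    · exact a1
    · exact a2
    · exact tr a1 a3
  · have a1 := h Corner.nw
    have a2 := h' Corner.nw
    have a3 := h Corner.ne
    cases c
    · exact (D.circleSetoid s).refl _
    · exact a2
    · exact a1
    · exact tr a2 a3

/-- The ends on one of the two circles through the crossing `x`. -/
def Touches (D : LinkDiagram X) (t : X → Label) (x : X) (p : X × Corner) : Prop :=
  D.circleSetoid t (x, Corner.nw) p ∨ D.circleSetoid t (x, Corner.se) p

/-- Going from `t` to `s` merges the two circles at `x` and keeps all others. For the forward
direction, the right-hand side is an equivalence relation that contains the generators of the circle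
relation of `s`. -/
theorem circleSetoid_iff_of_separated [Finite X] (D : LinkDiagram X) {s t : X → Label} {x : X}
    (hst : ∀ y, y ≠ x → t y = s y) (hne : s x ≠ t x) (hx : D.Separated t x) (p q : X × Corner) :
    D.circleSetoid s p q ↔
      D.circleSetoid t p q ∨ (D.Touches t x p ∧ D.Touches t x q) := by
  have tr := @(D.circleSetoid t).trans
  have sy := @(D.circleSetoid t).symm
  have htouch : ∀ {p q}, D.circleSetoid t p q → D.Touches t x p → D.Touches t x q := by
    rintro p q h (h1 | h1)
    · exact Or.inl (tr h1 h)
    · exact Or.inr (tr h1 h)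
  have hle : D.circleSetoid t ≤ D.circleSetoid s := by
    refine D.circleSetoid_le t _ (D.circleSetoid_glue s) ?_
    rintro ⟨y, c⟩
    by_cases hy : y = x
    · subst hy
      exact D.circleSetoid_smooth_of_separated hst hx c
    · rw [D.smooth_congr (hst _ hy)]; exact D.circleSetoid_smooth s _
  constructor
  · intro h
    let r : Setoid (X × Corner) :=
      { r := fun p q => D.circleSetoid t p q ∨ (D.Touches t x p ∧ D.Touches t x q)
        iseqv :=
          { refl := fun p => Or.inl ((D.circleSetoid t).refl p)
            symm := by
              rintro p q (h | ⟨h1, h2⟩)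
              · exact Or.inl (sy h)
              · exact Or.inr ⟨h2, h1⟩
            trans := by
              rintro p q r (h | ⟨h1, h2⟩) (h' | ⟨h1', h2'⟩)
              · exact Or.inl (tr h h')
              · exact Or.inr ⟨htouch (sy h) h1', h2'⟩
              · exact Or.inr ⟨h1, htouch h' h2⟩
              · exact Or.inr ⟨h1, h2'⟩ } }
    refine D.circleSetoid_le s r (fun p => Or.inl (D.circleSetoid_glue t p)) ?_ h
    rintro ⟨y, c⟩
    by_cases hy : y = x
    · subst hy
      exact Or.inr ⟨D.circleSetoid_corner t y c, D.circleSetoid_corner t y _⟩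
    · refine Or.inl ?_
      rw [← D.smooth_congr (hst _ hy)]; exact D.circleSetoid_smooth t _
  · rintro (h | ⟨h1, h2⟩)
    · exact hle h
    · have key : ∀ p, D.Touches t x p → D.circleSetoid s (x, Corner.nw) p := by
        rintro p (h | h)
        · exact hle h
        · exact (D.circleSetoid s).trans (D.circleSetoid_corner_of_separated hst hne hx Corner.se)
            (hle h)
      exact (D.circleSetoid s).trans ((D.circleSetoid s).symm (key p h1)) (key q h2)

/-! ### Circle sums, degrees and adjacency at a splitting crossing -/

noncomputable instance circleFintype [Finite X] (D : LinkDiagram X) (s : X → Label) :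
    Fintype (D.Circle s) :=
  Fintype.ofFinite _

open Classical in
/-- A sum over the circles of `sD` as a sum over the circles of `tD`. -/
theorem sum_circle_of_separated [Finite X] (D : LinkDiagram X) {s t : X → Label} {x : X}
    (hst : ∀ y, y ≠ x → t y = s y) (hne : s x ≠ t x) (hx : D.Separated t x)
    (f : D.Circle s → ℤ) (g : D.Circle t → ℤ)
    (hfg : ∀ p, ¬ D.Touches t x p → g (D.circleThrough t p) = f (D.circleThrough s p)) :
    ∑ C, g C = ∑ C, f C + g (D.circleThrough t (x, Corner.nw)) +
      g (D.circleThrough t (x, Corner.se)) - f (D.circleThrough s (x, Corner.nw)) := by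
  have hiff := D.circleSetoid_iff_of_separated hst hne hx
  set U := D.circleThrough t (x, Corner.nw)
  set L := D.circleThrough t (x, Corner.se)
  set m := D.circleThrough s (x, Corner.nw)
  have hUL : U ≠ L := fun h => hx ((D.circleThrough_eq_iff _ _ _).1 h)
  have hT : ∀ p, D.Touches t x p ↔ (D.circleThrough t p = U ∨ D.circleThrough t p = L) := by
    intro p
    simp only [U, L, circleThrough_eq_iff]
    exact or_congr ⟨(D.circleSetoid t).symm, (D.circleSetoid t).symm⟩
      ⟨(D.circleSetoid t).symm, (D.circleSetoid t).symm⟩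
  have hm : ∀ p, D.circleThrough s p = m ↔ D.Touches t x p := by
    intro p
    simp only [m, circleThrough_eq_iff, hiff]
    constructor
    · rintro (h | h)
      · exact Or.inl ((D.circleSetoid t).symm h)
      · exact h.1
    · exact fun h => Or.inr ⟨h, Or.inl ((D.circleSetoid t).refl _)⟩
  have h1 : ∑ C, f C = f m + ∑ C ∈ Finset.univ.erase m, f C :=
    (Finset.add_sum_erase _ _ (Finset.mem_univ m)).symm
  have h2 : ∑ C, g C = g U + (g L + ∑ C ∈ (Finset.univ.erase U).erase L, g C) := by
    rw [Finset.add_sum_erase _ _ (Finset.mem_erase.2 ⟨hUL.symm, Finset.mem_univ _⟩),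
      Finset.add_sum_erase _ _ (Finset.mem_univ _)]
  -- Away from `x` the circles of `t` and of `s` are in bijection, by taking the circle through the
  -- same end.
  have h3 : ∑ C ∈ (Finset.univ.erase U).erase L, g C = ∑ C ∈ Finset.univ.erase m, f C := by
    refine Finset.sum_bij
      (fun C _ => Quotient.map' (s₂ := D.circleSetoid s) id (fun p q h => (hiff p q).2 (Or.inl h)) C)
      ?_ ?_ ?_ ?_
    · intro C hC
      induction C using Quotient.inductionOn with | _ p => ?_
      simp only [Finset.mem_erase, Finset.mem_univ, and_true] at hC ⊢
      intro h
      have := (hT p).1 ((hm p).1 h)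
      tauto
    · intro C hC C' hC' h
      induction C using Quotient.inductionOn with | _ p => ?_
      induction C' using Quotient.inductionOn with | _ q => ?_
      simp only [Finset.mem_erase, Finset.mem_univ, and_true] at hC hC'
      have h' : D.circleThrough s p = D.circleThrough s q := h
      rw [circleThrough_eq_iff, hiff] at h'
      rcases h' with h' | ⟨h', -⟩
      · exact Quotient.sound h'
      · have := (hT p).1 h'
        tauto
    · intro C hC
      induction C using Quotient.inductionOn with | _ p => ?_
      simp only [Finset.mem_erase, Finset.mem_univ, and_true] at hC
      have hp : ¬ D.Touches t x p := fun h => hC ((hm p).2 h)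
      rw [hT] at hp
      refine ⟨D.circleThrough t p, ?_, rfl⟩
      simp only [Finset.mem_erase, Finset.mem_univ, and_true]
      tauto
    · intro C hC
      induction C using Quotient.inductionOn with | _ p => ?_
      simp only [Finset.mem_erase, Finset.mem_univ, and_true] at hC
      refine hfg p fun h => ?_
      have := (hT p).1 h
      tauto
  rw [h1, h2, h3]
  ring

theorem card_circle_of_separated [Finite X] (D : LinkDiagram X) {s t : X → Label} {x : X}
    (hst : ∀ y, y ≠ x → t y = s y) (hne : s x ≠ t x) (hx : D.Separated t x) :
    (Fintype.card (D.Circle t) : ℤ) = Fintype.card (D.Circle s) + 1 := by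
  have := D.sum_circle_of_separated hst hne hx (fun _ => 1) (fun _ => 1) (fun _ _ => rfl)
  simpa using this

theorem theta_eq_sum [Finite X] (D : LinkDiagram X) (s : D.EnhancedState) :
    D.theta s = ∑ C, (s.2 C : ℤ) := by
  classical
  unfold theta
  rw [Nat.card_eq_fintype_card, Nat.card_eq_fintype_card, Fintype.card_subtype,
    Fintype.card_subtype, Finset.card_filter, Finset.card_filter]
  push_cast
  rw [← Finset.sum_sub_distrib]
  refine Finset.sum_congr rfl fun C _ => ?_
  rcases Int.units_eq_one_or (s.2 C) with h | h <;> simp [h]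

theorem homDegree_eq_add_one [Finite X] (D : LinkDiagram X) {s t : D.EnhancedState} {x : X}
    (hst : ∀ y, y ≠ x → t.1 y = s.1 y) (hs : s.1 x = Label.A) (ht : t.1 x = Label.B) :
    D.homDegree t = D.homDegree s + 1 := by
  classical
  have := Fintype.ofFinite X
  unfold homDegree
  rw [Nat.card_eq_fintype_card, Nat.card_eq_fintype_card, Fintype.card_subtype,
    Fintype.card_subtype]
  have : (Finset.univ.filter fun y => t.1 y = Label.B) =
      insert x (Finset.univ.filter fun y => s.1 y = Label.B) := by
    ext y
    by_cases hy : y = x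
    · simp [hy, ht]
    · simp [hy, hst y hy]
  rw [this, Finset.card_insert_of_notMem (by simp [hs])]
  push_cast
  rfl

/-- Adjacency at a crossing whose arcs lie on different circles of `tD`: the signs agree on the
circles away from the crossing, and the signs near it are as in the comultiplication. -/
theorem adjacentAt_iff_of_separated [Finite X] (D : LinkDiagram X) {s t : D.EnhancedState} {x : X}
    (hst : ∀ y, y ≠ x → t.1 y = s.1 y) (hs : s.1 x = Label.A) (ht : t.1 x = Label.B)
    (hx : D.Separated t.1 x) :
    D.AdjacentAt x s t ↔
      (∀ p, ¬ D.Touches t.1 x p → t.2 (D.circleThrough t.1 p) = s.2 (D.circleThrough s.1 p)) ∧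
      (t.2 (D.circleThrough t.1 (x, Corner.nw)) : ℤ) + t.2 (D.circleThrough t.1 (x, Corner.se)) =
        s.2 (D.circleThrough s.1 (x, Corner.nw)) - 1 := by
  have hne : s.1 x ≠ t.1 x := by rw [hs, ht]; decide
  have hiff := D.circleSetoid_iff_of_separated hst hne hx
  -- The common circles are those that miss `x`: the merged circle contains both `nw` and `se`,
  -- which `t` separates.
  have hcommon : ∀ p, (∀ q, D.circleSetoid s.1 p q ↔ D.circleSetoid t.1 p q) ↔
      ¬ D.Touches t.1 x p := by
    intro p
    constructor
    · intro h hp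
      apply hx
      have h1 := (h (x, Corner.nw)).1
        ((hiff _ _).2 (Or.inr ⟨hp, Or.inl ((D.circleSetoid t.1).refl _)⟩))
      have h2 := (h (x, Corner.se)).1
        ((hiff _ _).2 (Or.inr ⟨hp, Or.inr ((D.circleSetoid t.1).refl _)⟩))
      exact (D.circleSetoid t.1).trans ((D.circleSetoid t.1).symm h1) h2
    · intro hp q
      rw [hiff]
      tauto
  unfold AdjacentAt
  simp only [hcommon]
  have hq : (∀ p, ¬ D.Touches t.1 x p →
      t.2 (D.circleThrough t.1 p) = s.2 (D.circleThrough s.1 p)) →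
      (D.quantumDegree t = D.quantumDegree s ↔
        (t.2 (D.circleThrough t.1 (x, Corner.nw)) : ℤ) +
        t.2 (D.circleThrough t.1 (x, Corner.se)) =
        s.2 (D.circleThrough s.1 (x, Corner.nw)) - 1) := by
    intro h
    unfold quantumDegree
    rw [D.homDegree_eq_add_one hst hs ht, theta_eq_sum, theta_eq_sum,
      D.sum_circle_of_separated hst hne hx (fun C => (s.2 C : ℤ)) (fun C => (t.2 C : ℤ))
        (fun p hp => by rw [h p hp])]
    constructor <;> intro h <;> linarith
  tauto

end LinkDiagram

/-! ### The differential in coordinates and a functional modulo 2 that kills boundaries -/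

namespace LinkDiagram

variable {X : Type}

noncomputable instance statesOfDegreeFintype [Finite X] (D : LinkDiagram X) (i j : ℤ) :
    Fintype (D.StatesOfDegree i j) :=
  Fintype.ofFinite _

theorem differential_apply [Fintype X] (D : LinkDiagram X) (num : X ↪ ℕ) (i i' j : ℤ)
    (z : D.Chain i j) (t : D.StatesOfDegree i' j) :
    D.differential num i i' j z t = ∑ s, z s * D.incidence num s.1 t.1 := by
  unfold differential
  rw [Finsupp.linearCombination_apply, Finsupp.sum_fintype _ _ (by simp), Finsupp.finsetSum_apply]
  simp

open Classical in
/-- The chain `∑ S, c(S) (S, σ(S))` for a choice `σ` of signs on the circles of every Kauffman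
state. -/
noncomputable def sectionChain [Finite X] (D : LinkDiagram X) (i j : ℤ)
    (σ : ∀ S, D.Circle S → ℤˣ) (c : (X → Label) → ℤ) : D.Chain i j :=
  Finsupp.equivFunOnFinite.symm fun s => if s.1.2 = σ s.1.1 then c s.1.1 else 0

open Classical in
theorem sectionChain_apply [Finite X] (D : LinkDiagram X) (i j : ℤ)
    (σ : ∀ S, D.Circle S → ℤˣ) (c : (X → Label) → ℤ) (s : D.StatesOfDegree i j) :
    D.sectionChain i j σ c s = if s.1.2 = σ s.1.1 then c s.1.1 else 0 := rfl

theorem AdjacentAt.eq_update [DecidableEq X] {D : LinkDiagram X} {x : X} {s t : D.EnhancedState}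
    (h : D.AdjacentAt x s t) : s.1 = Function.update t.1 x Label.A := by
  funext y
  by_cases hy : y = x
  · subst hy; simp [h.1]
  · simp [hy, h.2.2.1 y hy]

open Classical in
-- A predecessor of `t` at `x` has its labels forced, and the section forces its signs, so each
-- crossing gives at most one term. The hypothesis `hc` guarantees that this predecessor does occur
-- in the chain module whenever its coefficient is nonzero.
theorem differential_sectionChain_apply [Fintype X] [DecidableEq X] (D : LinkDiagram X) (num : X ↪ ℕ)
    (i i' j : ℤ) (σ : ∀ S, D.Circle S → ℤˣ) (c : (X → Label) → ℤ)
    (hc : ∀ S, c S ≠ 0 → D.homDegree ⟨S, σ S⟩ = i ∧ D.quantumDegree ⟨S, σ S⟩ = j)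
    (t : D.StatesOfDegree i' j) :
    D.differential num i i' j (D.sectionChain i j σ c) t =
      ∑ x, if D.AdjacentAt x ⟨Function.update t.1.1 x Label.A, σ _⟩ t.1 then
        c (Function.update t.1.1 x Label.A) *
          (-1) ^ Nat.card {y // num y < num x ∧ Function.update t.1.1 x Label.A y = Label.B}
        else 0 := by
  rw [differential_apply]
  simp only [incidence, Finset.mul_sum]
  rw [Finset.sum_comm]
  refine Finset.sum_congr rfl fun x _ => ?_
  have hzero : ∀ s : D.StatesOfDegree i j,
      s.1 ≠ ⟨Function.update t.1.1 x Label.A, σ _⟩ →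
      (D.sectionChain i j σ c s * if D.AdjacentAt x s.1 t.1 then
        (-1) ^ Nat.card {y : X // num y < num x ∧ s.1.1 y = Label.B} else 0) = 0 := by
    rintro ⟨⟨S, τ⟩, hs⟩ hne
    rw [sectionChain_apply]
    by_cases hadj : D.AdjacentAt x ⟨S, τ⟩ t.1
    · have hS : S = _ := hadj.eq_update
      subst hS
      rw [if_neg, zero_mul]
      intro h
      have h' : τ = σ _ := h
      subst h'
      exact hne rfl
    · rw [if_neg hadj, mul_zero]
  by_cases hcz : c (Function.update t.1.1 x Label.A) = 0
  · rw [Finset.sum_eq_zero]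
    · simp [hcz]
    · intro s _
      by_cases hs : s.1 = ⟨Function.update t.1.1 x Label.A, σ _⟩
      · rw [sectionChain_apply, hs, hcz]; simp
      · exact hzero s hs
  · rw [Finset.sum_eq_single ⟨⟨Function.update t.1.1 x Label.A, σ _⟩, hc _ hcz⟩]
    · rw [sectionChain_apply, if_pos rfl, mul_ite, mul_zero]
    · intro s _ hs
      exact hzero s fun h => hs (Subtype.ext h)
    · simp

open Classical in
/-- The sign `-` on the circle `C`, and `+` on the other circles. -/
noncomputable def minusAt (D : LinkDiagram X) {S : X → Label} (C : D.Circle S) :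
    D.Circle S → ℤˣ :=
  fun C' => if C' = C then -1 else 1

theorem minusAt_self (D : LinkDiagram X) {S : X → Label} (C : D.Circle S) :
    D.minusAt C C = -1 := if_pos rfl

theorem minusAt_of_ne (D : LinkDiagram X) {S : X → Label} {C C' : D.Circle S} (h : C' ≠ C) :
    D.minusAt C C' = 1 := if_neg h

open Classical in
/-- The sum modulo `2` of the coefficients of the enhanced states with the underlying Kauffman state
`S` and with exactly one negative circle. -/
noncomputable def oneMinus [Finite X] (D : LinkDiagram X) (i j : ℤ) (S : X → Label) :
    D.Chain i j →ₗ[ℤ] ZMod 2 :=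
  Finsupp.linearCombination ℤ fun s : D.StatesOfDegree i j =>
    if ∃ C : D.Circle S, s.1 = ⟨S, D.minusAt C⟩ then (1 : ZMod 2) else 0

open Classical in
theorem oneMinus_apply [Finite X] (D : LinkDiagram X) (i j : ℤ) (S : X → Label)
    (z : D.Chain i j) :
    D.oneMinus i j S z =
      ∑ s, (z s : ZMod 2) * if ∃ C : D.Circle S, s.1 = ⟨S, D.minusAt C⟩ then 1 else 0 := by
  unfold oneMinus
  rw [Finsupp.linearCombination_apply, Finsupp.sum_fintype _ _ (by simp)]
  exact Finset.sum_congr rfl fun s _ => by rw [zsmul_eq_mul]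

theorem circleThrough_ne_of_not_touches (D : LinkDiagram X) {S : X → Label} {x : X}
    {p : X × Corner} (h : ¬ D.Touches S x p) :
    D.circleThrough S p ≠ D.circleThrough S (x, Corner.nw) ∧
      D.circleThrough S p ≠ D.circleThrough S (x, Corner.se) := by
  simp only [ne_eq, circleThrough_eq_iff]
  exact ⟨fun h' => h (Or.inl ((D.circleSetoid S).symm h')),
    fun h' => h (Or.inr ((D.circleSetoid S).symm h'))⟩

theorem adjacentAt_mk_iff_of_separated [Finite X] (D : LinkDiagram X) {S S' : X → Label} {x : X}
    {σ : D.Circle S → ℤˣ} {τ : D.Circle S' → ℤˣ}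
    (hst : ∀ y, y ≠ x → S' y = S y) (hs : S x = Label.A) (ht : S' x = Label.B)
    (hx : D.Separated S' x) :
    D.AdjacentAt x ⟨S, σ⟩ ⟨S', τ⟩ ↔
      (∀ p, ¬ D.Touches S' x p → τ (D.circleThrough S' p) = σ (D.circleThrough S p)) ∧
      (τ (D.circleThrough S' (x, Corner.nw)) : ℤ) + τ (D.circleThrough S' (x, Corner.se)) =
        σ (D.circleThrough S (x, Corner.nw)) - 1 :=
  D.adjacentAt_iff_of_separated (s := ⟨S, σ⟩) (t := ⟨S', τ⟩) hst hs ht hx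

/-- Comultiplication is symmetric: a positive circle that splits gives its new minus sign to either
of the two parts. -/
theorem adjacentAt_minusAt_swap [Finite X] (D : LinkDiagram X) {S : X → Label} {x : X}
    (hx : D.Separated S x) {R : X → Label} {ρ : D.Circle R → ℤˣ} {p q : X × Corner}
    (hpq : (p = (x, Corner.nw) ∧ q = (x, Corner.se)) ∨ (p = (x, Corner.se) ∧ q = (x, Corner.nw)))
    (h : D.AdjacentAt x ⟨R, ρ⟩ ⟨S, D.minusAt (D.circleThrough S p)⟩) :
    D.AdjacentAt x ⟨R, ρ⟩ ⟨S, D.minusAt (D.circleThrough S q)⟩ := by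
  have hne : D.circleThrough S (x, Corner.nw) ≠ D.circleThrough S (x, Corner.se) :=
    fun h => hx ((D.circleThrough_eq_iff _ _ _).1 h)
  have h0 := h
  rw [D.adjacentAt_mk_iff_of_separated h.2.2.1 h.1 h.2.1 hx] at h
  rw [D.adjacentAt_mk_iff_of_separated h0.2.2.1 h0.1 h0.2.1 hx]
  obtain ⟨h1, h2⟩ := h
  refine ⟨fun r hr => ?_, ?_⟩
  · rw [← h1 r hr]
    obtain ⟨e1, e2⟩ := D.circleThrough_ne_of_not_touches hr
    rcases hpq with ⟨rfl, rfl⟩ | ⟨rfl, rfl⟩ <;>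
      simp only [D.minusAt_of_ne e1, D.minusAt_of_ne e2]
  · rw [← h2]
    rcases hpq with ⟨rfl, rfl⟩ | ⟨rfl, rfl⟩ <;>
      simp only [D.minusAt_of_ne hne, D.minusAt_of_ne hne.symm, minusAt_self] <;> norm_num

/-- Every term of a comultiplication has a minus sign on at least one of the two new circles, so a
unique negative circle must be one of them. -/
theorem eq_of_adjacentAt_minusAt [Finite X] (D : LinkDiagram X) {S : X → Label} {x : X}
    (hx : D.Separated S x) {R : X → Label} {ρ : D.Circle R → ℤˣ} {C : D.Circle S}
    (h : D.AdjacentAt x ⟨R, ρ⟩ ⟨S, D.minusAt C⟩) :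
    C = D.circleThrough S (x, Corner.nw) ∨ C = D.circleThrough S (x, Corner.se) := by
  by_contra hcon
  push Not at hcon
  rw [D.adjacentAt_mk_iff_of_separated h.2.2.1 h.1 h.2.1 hx] at h
  have h2 := h.2
  rw [D.minusAt_of_ne hcon.1.symm, D.minusAt_of_ne hcon.2.symm] at h2
  rcases Int.units_eq_one_or (ρ (D.circleThrough R (x, Corner.nw))) with h | h <;>
    rw [h] at h2 <;> norm_num at h2

/-- For a fixed source and change crossing, the targets over `S` with one negative circle come as a
pair `(+-)`, `(-+)` or not at all. The incidence sign depends only on the source, so the two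
contributions are equal and cancel modulo 2. -/
theorem oneMinus_differential [Fintype X] (D : LinkDiagram X) (num : X ↪ ℕ) (i i' j : ℤ)
    {S : X → Label} (hS : ∀ x, S x = Label.B → D.Separated S x) (z : D.Chain i j) :
    D.oneMinus i' j S (D.differential num i i' j z) = 0 := by
  classical
  rw [oneMinus_apply]
  simp only [differential_apply, Int.cast_sum, Int.cast_mul, Finset.sum_mul, incidence]
  rw [Finset.sum_comm]
  refine Finset.sum_eq_zero fun t _ => ?_
  simp only [Finset.mul_sum, Finset.sum_mul]
  rw [Finset.sum_comm]
  refine Finset.sum_eq_zero fun x _ => ?_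
  by_cases hex : ∃ s : D.StatesOfDegree i' j, D.AdjacentAt x t.1 s.1 ∧
      ∃ C : D.Circle S, s.1 = ⟨S, D.minusAt C⟩
  swap
  · push Not at hex
    refine Finset.sum_eq_zero fun s _ => ?_
    by_cases h : D.AdjacentAt x t.1 s.1
    · rw [if_neg (c := ∃ C, _) (not_exists.2 (hex s h)), mul_zero]
    · simp [h]
  obtain ⟨s, hadj, C, hC⟩ := hex
  rw [hC] at hadj
  have hx : D.Separated S x := hS x hadj.2.1
  have hUL : D.circleThrough S (x, Corner.nw) ≠ D.circleThrough S (x, Corner.se) :=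
    fun h => hx ((D.circleThrough_eq_iff _ _ _).1 h)
  have both : D.AdjacentAt x t.1 ⟨S, D.minusAt (D.circleThrough S (x, Corner.nw))⟩ ∧
      D.AdjacentAt x t.1 ⟨S, D.minusAt (D.circleThrough S (x, Corner.se))⟩ := by
    rcases D.eq_of_adjacentAt_minusAt hx hadj with rfl | rfl
    · exact ⟨hadj, D.adjacentAt_minusAt_swap hx (Or.inl ⟨rfl, rfl⟩) hadj⟩
    · exact ⟨D.adjacentAt_minusAt_swap hx (Or.inr ⟨rfl, rfl⟩) hadj, hadj⟩
  have hhom : ∀ τ : D.Circle S → ℤˣ, D.homDegree ⟨S, τ⟩ = i' := by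
    intro τ
    have := s.2.1
    rw [hC] at this
    exact this
  rw [Finset.sum_eq_add
    (⟨⟨S, D.minusAt (D.circleThrough S (x, Corner.nw))⟩, hhom _,
      both.1.2.2.2.1.trans t.2.2⟩ : D.StatesOfDegree i' j)
    (⟨⟨S, D.minusAt (D.circleThrough S (x, Corner.se))⟩, hhom _,
      both.2.2.2.2.1.trans t.2.2⟩ : D.StatesOfDegree i' j)]
  · rw [if_pos both.1, if_pos both.2, if_pos ⟨_, rfl⟩, if_pos ⟨_, rfl⟩]
    exact CharTwo.add_self_eq_zero _
  · intro h
    have h1 : (⟨S, D.minusAt (D.circleThrough S (x, Corner.nw))⟩ : D.EnhancedState) =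
      ⟨S, D.minusAt (D.circleThrough S (x, Corner.se))⟩ := congrArg Subtype.val h
    have h2 := congrFun (eq_of_heq (Sigma.mk.inj h1).2) (D.circleThrough S (x, Corner.nw))
    rw [minusAt_self, D.minusAt_of_ne hUL] at h2
    exact absurd h2 (by decide)
  · rintro ⟨r, hr⟩ - ⟨h1, h2⟩
    by_cases h : D.AdjacentAt x t.1 r
    · rw [if_neg (c := ∃ C, _), mul_zero]
      rintro ⟨C', rfl⟩
      rcases D.eq_of_adjacentAt_minusAt hx h with rfl | rfl
      · exact h1 rfl
      · exact h2 rfl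
    · simp [h]
  · simp
  · simp

/-- The homology class of a cycle. -/
noncomputable abbrev homologyClass [Fintype X] (D : LinkDiagram X) (num : X ↪ ℕ) (i j : ℤ)
    (z : LinearMap.ker (D.differential num i (i + 1) j)) : D.DiagramHomology num i j :=
  Submodule.Quotient.mk z

/-- The map which `oneMinus` induces on homology. -/
noncomputable def oneMinusHomology [Fintype X] (D : LinkDiagram X) (num : X ↪ ℕ) (i j : ℤ)
    {S : X → Label} (hS : ∀ x, S x = Label.B → D.Separated S x) :
    D.DiagramHomology num i j →ₗ[ℤ] ZMod 2 :=
  Submodule.liftQ _ (D.oneMinus i j S ∘ₗ Submodule.subtype _) (by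
    rintro ⟨z, hz⟩ hz'
    obtain ⟨w, rfl⟩ : ∃ w, D.differential num (i - 1) i j w = z := hz'
    exact D.oneMinus_differential num _ _ j hS w)

theorem oneMinusHomology_class [Fintype X] (D : LinkDiagram X) (num : X ↪ ℕ) (i j : ℤ)
    {S : X → Label} (hS : ∀ x, S x = Label.B → D.Separated S x)
    (z : LinearMap.ker (D.differential num i (i + 1) j)) :
    D.oneMinusHomology num i j hS (D.homologyClass num i j z) = D.oneMinus i j S z.1 := rfl

theorem nonempty_zmultiples_addEquiv {G : Type*} [AddGroup G] {g : G} (h2 : 2 • g = 0)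
    (h0 : g ≠ 0) : Nonempty (AddSubgroup.zmultiples g ≃+ ZMod 2) := by
  have := Fact.mk Nat.prime_two
  have hord : addOrderOf g = 2 := addOrderOf_eq_prime h2 h0
  have hcard : Nat.card (AddSubgroup.zmultiples g) = 2 := by rw [Nat.card_zmultiples, hord]
  exact ⟨((ZMod.ringEquivCongr hcard).symm.toAddEquiv.trans (zmodAddCyclicAddEquiv inferInstance)).symm⟩

theorem two_nsmul_homologyClass [Fintype X] (D : LinkDiagram X) (num : X ↪ ℕ) (i j : ℤ)
    (z : LinearMap.ker (D.differential num i (i + 1) j)) (w : D.Chain (i - 1) j)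
    (h : D.differential num (i - 1) i j w = 2 • z.1) :
    2 • D.homologyClass num i j z = 0 := by
  refine (Submodule.Quotient.mk_eq_zero _ (x := 2 • z)).2 ?_
  exact ⟨w, h⟩

end LinkDiagram

/-! ### States whose negative circles are those through a base end -/

namespace LinkDiagram

variable {X : Type}

/-- The circle `C` passes through an end in `base`. -/
def MeetsBase (D : LinkDiagram X) (base : Set (X × Corner)) {S : X → Label} (C : D.Circle S) :
    Prop :=
  ∃ p ∈ base, C = D.circleThrough S p

open Classical in
/-- The sign `-` on the circles through the ends in `base`, and `+` on the other circles. -/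
noncomputable def baseSigns (D : LinkDiagram X) (base : Set (X × Corner)) (S : X → Label) :
    D.Circle S → ℤˣ :=
  fun C => if D.MeetsBase base C then -1 else 1

open Classical in
/-- The indicator of the circles `C` away from `base` such that `τ` is negative exactly on `C` and
on the circles through `base`. -/
noncomputable def extraMinus (D : LinkDiagram X) (base : Set (X × Corner)) {S : X → Label}
    (τ : D.Circle S → ℤˣ) (C : D.Circle S) : ℤ :=
  if ¬ D.MeetsBase base C ∧ ∀ C', τ C' = -1 ↔ (C' = C ∨ D.MeetsBase base C') then 1 else 0

theorem units_eq_neg_one_iff (u : ℤˣ) : u = -1 ↔ ¬ u = 1 := by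
  rcases Int.units_eq_one_or u with h | h <;> rw [h] <;> decide

open Classical in
/-- The states adjacent to a state whose negative circles are those through `base` have one more
negative circle, which is one of the two circles at the crossing. -/
theorem adjacentAt_baseSigns [Finite X] (D : LinkDiagram X) {base : Set (X × Corner)}
    (hbase : base.Subsingleton) {S S' : X → Label} {x : X} (τ : D.Circle S' → ℤˣ)
    (hst : ∀ y, y ≠ x → S' y = S y) (hs : S x = Label.A) (ht : S' x = Label.B)
    (hx : D.Separated S' x) :
    (if D.AdjacentAt x ⟨S, D.baseSigns base S⟩ ⟨S', τ⟩ then 1 else 0 : ℤ) =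
      D.extraMinus base τ (D.circleThrough S' (x, Corner.nw)) +
      D.extraMinus base τ (D.circleThrough S' (x, Corner.se)) := by
  have hiff := D.circleSetoid_iff_of_separated hst (by rw [hs, ht]; decide) hx
  have hUL : D.circleThrough S' (x, Corner.nw) ≠ D.circleThrough S' (x, Corner.se) :=
    fun h => hx ((D.circleThrough_eq_iff _ _ _).1 h)
  -- As `base` has at most one end, it cannot meet two distinct circles.
  have hnb : ¬ (D.MeetsBase base (D.circleThrough S' (x, Corner.nw)) ∧
      D.MeetsBase base (D.circleThrough S' (x, Corner.se))) := by
    rintro ⟨⟨p, hp, h1⟩, q, hq, h2⟩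
    rw [hbase hp hq] at h1
    exact hUL (h1.trans h2.symm)
  have hm : D.MeetsBase base (D.circleThrough S (x, Corner.nw)) ↔
      (D.MeetsBase base (D.circleThrough S' (x, Corner.nw)) ∨
        D.MeetsBase base (D.circleThrough S' (x, Corner.se))) := by
    unfold MeetsBase
    simp only [circleThrough_eq_iff, hiff]
    constructor
    · rintro ⟨p, hp, h | ⟨-, h | h⟩⟩
      · exact Or.inl ⟨p, hp, h⟩
      · exact Or.inl ⟨p, hp, h⟩
      · exact Or.inr ⟨p, hp, h⟩
    · rintro (⟨p, hp, h⟩ | ⟨p, hp, h⟩)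
      · exact ⟨p, hp, Or.inl h⟩
      · exact ⟨p, hp, Or.inr ⟨Or.inl ((D.circleSetoid S').refl _), Or.inr h⟩⟩
  have hp : ∀ p, ¬ D.Touches S' x p →
      (D.MeetsBase base (D.circleThrough S p) ↔ D.MeetsBase base (D.circleThrough S' p)) := by
    intro p hp
    unfold MeetsBase
    simp only [circleThrough_eq_iff, hiff]
    simp [hp]
  have hN : (∀ p, ¬ D.Touches S' x p →
      τ (D.circleThrough S' p) = D.baseSigns base S (D.circleThrough S p)) ↔
      ∀ p, ¬ D.Touches S' x p →
        (τ (D.circleThrough S' p) = -1 ↔ D.MeetsBase base (D.circleThrough S' p)) := by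
    refine forall₂_congr fun p h => ?_
    unfold baseSigns
    rw [hp p h]
    split_ifs with hb
    · simp [hb]
    · simp [hb, units_eq_neg_one_iff]
  have hall : ∀ C, (C = D.circleThrough S' (x, Corner.nw) ∨
      C = D.circleThrough S' (x, Corner.se)) →
      ((∀ C', τ C' = -1 ↔ (C' = C ∨ D.MeetsBase base C')) ↔
      ((∀ p, ¬ D.Touches S' x p →
        (τ (D.circleThrough S' p) = -1 ↔ D.MeetsBase base (D.circleThrough S' p))) ∧
      (τ (D.circleThrough S' (x, Corner.nw)) = -1 ↔ (D.circleThrough S' (x, Corner.nw) = C ∨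
        D.MeetsBase base (D.circleThrough S' (x, Corner.nw)))) ∧
      (τ (D.circleThrough S' (x, Corner.se)) = -1 ↔ (D.circleThrough S' (x, Corner.se) = C ∨
        D.MeetsBase base (D.circleThrough S' (x, Corner.se)))))) := by
    intro C hC
    constructor
    · intro h
      refine ⟨fun p hp => ?_, h _, h _⟩
      obtain ⟨e1, e2⟩ := D.circleThrough_ne_of_not_touches hp
      rw [h]
      have : D.circleThrough S' p ≠ C := by rcases hC with rfl | rfl <;> assumption
      simp [this]
    · rintro ⟨h1, h2, h3⟩ C'
      induction C' using Quotient.inductionOn with | _ p => ?_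
      change τ (D.circleThrough S' p) = -1 ↔
        (D.circleThrough S' p = C ∨ D.MeetsBase base (D.circleThrough S' p))
      by_cases ht : D.Touches S' x p
      · rcases ht with ht | ht
        · rw [← (D.circleThrough_eq_iff _ _ _).2 ht]; exact h2
        · rw [← (D.circleThrough_eq_iff _ _ _).2 ht]; exact h3
      · obtain ⟨e1, e2⟩ := D.circleThrough_ne_of_not_touches ht
        have : D.circleThrough S' p ≠ C := by rcases hC with rfl | rfl <;> assumption
        rw [h1 p ht]
        simp [this]
  unfold extraMinus
  rw [hall _ (Or.inl rfl), hall _ (Or.inr rfl)]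
  rw [if_congr (D.adjacentAt_mk_iff_of_separated hst hs ht hx) rfl rfl, hN]
  have hms : D.baseSigns base S (D.circleThrough S (x, Corner.nw)) =
    if D.MeetsBase base (D.circleThrough S' (x, Corner.nw)) ∨
        D.MeetsBase base (D.circleThrough S' (x, Corner.se)) then -1 else 1 := by
    unfold baseSigns
    exact if_congr hm rfl rfl
  rw [hms]
  generalize (∀ p, ¬ D.Touches S' x p →
        (τ (D.circleThrough S' p) = -1 ↔ D.MeetsBase base (D.circleThrough S' p))) = N
  by_cases hN : N
  swap
  · simp [hN]
  -- What remains concerns the two circles at `x` only: their signs in `τ` and whether they meet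
  -- `base`.
  have h1 : ¬ (1 : ℤˣ) = -1 := by decide
  rcases Int.units_eq_one_or (τ (D.circleThrough S' (x, Corner.nw))) with hu | hu <;>
  rcases Int.units_eq_one_or (τ (D.circleThrough S' (x, Corner.se))) with hl | hl <;>
  by_cases hbU : D.MeetsBase base (D.circleThrough S' (x, Corner.nw)) <;>
  by_cases hbL : D.MeetsBase base (D.circleThrough S' (x, Corner.se)) <;>
  simp [hN, hu, hl, hbU, hbL, hUL, hUL.symm, h1] at hnb ⊢

end LinkDiagram

/-! ### Changing the numbering of the crossings -/

section Reordering

variable {X : Type} [Fintype X]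

open Classical in
/-- The sign of the permutation that sorts the crossings with label `B`, which are ordered by `lt`,
with respect to the numbering `num`. -/
noncomputable def sortSign (lt : X → X → Prop) (num : X → ℕ) (S : X → Label) : ℤ :=
  ∏ y, ∏ z, if S y = Label.B ∧ S z = Label.B ∧ lt y z ∧ num z < num y then -1 else 1

theorem sortSign_mul_self (lt : X → X → Prop) (num : X → ℕ) (S : X → Label) :
    sortSign lt num S * sortSign lt num S = 1 := by
  unfold sortSign
  rw [← Finset.prod_mul_distrib]
  refine Finset.prod_eq_one fun y _ => ?_
  rw [← Finset.prod_mul_distrib]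
  refine Finset.prod_eq_one fun z _ => ?_
  split_ifs <;> rfl

open Classical in
theorem neg_one_pow_card_eq_prod (P : X → Prop) :
    (-1 : ℤ) ^ Nat.card {y // P y} = ∏ y, if P y then -1 else 1 := by
  rw [Nat.card_eq_fintype_card, Fintype.card_subtype, Finset.prod_ite]
  simp

/-- The sign of a change crossing `x` with respect to `num` and with respect to `lt`. -/
theorem sortSign_mul_neg_one_pow [DecidableEq X] {lt : X → X → Prop}
    (hlt : ∀ x y, x ≠ y → (lt x y ↔ ¬ lt y x)) {num : X → ℕ} (hnum : Function.Injective num)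
    {S S' : X → Label} {x : X} (hst : ∀ y, y ≠ x → S' y = S y) (hs : S x = Label.A)
    (ht : S' x = Label.B) :
    sortSign lt num S * (-1) ^ Nat.card {y // num y < num x ∧ S y = Label.B} =
      sortSign lt num S' * (-1) ^ Nat.card {y // lt y x ∧ S y = Label.B} := by
  classical
  rw [neg_one_pow_card_eq_prod, neg_one_pow_card_eq_prod]
  set v : X → ℤ := fun z => if S z = Label.B ∧ lt x z ∧ num z < num x then -1 else 1 with hv
  set w : X → ℤ := fun y => if S y = Label.B ∧ lt y x ∧ num x < num y then -1 else 1 with hw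
  -- The new inversions are those involving `x`: `v` records those with `x` first in the order `lt`,
  -- and `w` those with `x` second.
  have key : sortSign lt num S' = sortSign lt num S * (∏ z, v z) * ∏ y, w y := by
    have h1 : ∏ z, v z = ∏ y, ∏ z, if y = x then v z else 1 := by
      symm
      rw [Finset.prod_eq_single x]
      · simp
      · intro y _ hy; simp [hy]
      · simp
    have h2 : ∏ y, w y = ∏ y, ∏ z, if z = x then w y else 1 := by
      refine Finset.prod_congr rfl fun y _ => ?_
      simp
    rw [h1, h2]
    unfold sortSign
    rw [← Finset.prod_mul_distrib, ← Finset.prod_mul_distrib]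
    refine Finset.prod_congr rfl fun y _ => ?_
    rw [← Finset.prod_mul_distrib, ← Finset.prod_mul_distrib]
    refine Finset.prod_congr rfl fun z _ => ?_
    by_cases hy : y = x <;> by_cases hz : z = x
    · subst hy; subst hz; simp [hv, hw, hs]
    · subst hy; simp [hv, hz, hs, ht, hst z hz]
    · subst hz; simp [hw, hy, hs, ht, hst y hy]
    · simp [hy, hz, hst y hy, hst z hz]
  rw [key, mul_assoc, mul_assoc, ← Finset.prod_mul_distrib, ← Finset.prod_mul_distrib]
  congr 1
  refine Finset.prod_congr rfl fun z _ => ?_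
  by_cases hz : S z = Label.B
  · have hzx : z ≠ x := by rintro rfl; rw [hs] at hz; exact absurd hz (by decide)
    have h1 := hlt z x hzx
    have h2 : num z ≠ num x := fun h => hzx (hnum h)
    by_cases h3 : lt x z <;> rcases lt_or_gt_of_ne h2 with h4 | h4 <;>
      simp [hv, hw, hz, h1, h3, h4, h4.not_gt]
  · simp [hv, hw, hz]

end Reordering

/-! ### Circles in the smoothings of a pretzel diagram -/

namespace PretzelCrossing

variable {n : ℕ} {a : Fin n → ℤ}

open LinkDiagram

theorem smooth_pos_A (ha : ∀ l, a l ≠ 0) {S : PretzelCrossing a → Label} {x : PretzelCrossing a}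
    (hx : 0 < a x.1) (hS : S x = Label.A) (c : Corner) :
    (pretzelDiagram a ha).smooth S (x, c) = (x, c.vert) := by
  simp [smooth, pretzelDiagram, hx, hS]

theorem smooth_pos_B (ha : ∀ l, a l ≠ 0) {S : PretzelCrossing a → Label} {x : PretzelCrossing a}
    (hx : 0 < a x.1) (hS : S x = Label.B) (c : Corner) :
    (pretzelDiagram a ha).smooth S (x, c) = (x, c.horiz) := by
  simp [smooth, pretzelDiagram, hx, hS]

theorem smooth_neg_B (ha : ∀ l, a l ≠ 0) {S : PretzelCrossing a → Label} {x : PretzelCrossing a}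
    (hx : a x.1 < 0) (hS : S x = Label.B) (c : Corner) :
    (pretzelDiagram a ha).smooth S (x, c) = (x, c.vert) := by
  simp [smooth, pretzelDiagram, hx.not_gt, hS]

theorem glue_sw_of_lt (ha : ∀ l, a l ≠ 0) (l : Fin n) (k : ℕ) (h : k + 1 < (a l).natAbs) :
    (pretzelDiagram a ha).glue (⟨l, k, by omega⟩, Corner.sw) = (⟨l, k + 1, h⟩, Corner.nw) :=
  dif_pos h

theorem glue_se_of_lt (ha : ∀ l, a l ≠ 0) (l : Fin n) (k : ℕ) (h : k + 1 < (a l).natAbs) :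
    (pretzelDiagram a ha).glue (⟨l, k, by omega⟩, Corner.se) = (⟨l, k + 1, h⟩, Corner.ne) :=
  dif_pos h

/-- Two crossings in a positive column with the label `B` cut out a union of circles. -/
theorem separated_of_pos (ha : ∀ l, a l ≠ 0) {S : PretzelCrossing a → Label} {l : Fin n}
    (hl : 0 < a l) {k k' : Fin (a l).natAbs} (hne : k ≠ k') (hk : S ⟨l, k⟩ = Label.B)
    (hk' : S ⟨l, k'⟩ = Label.B) : (pretzelDiagram a ha).Separated S ⟨l, k⟩ := by
  -- The closed set is the part of the column between the two crossings: the lower ends of `lo`, the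
  -- upper ends of `hi`, and everything in between. Each of the two crossings has exactly one arc
  -- inside.
  have main : ∀ lo hi : Fin (a l).natAbs, lo < hi → S ⟨l, lo⟩ = Label.B → S ⟨l, hi⟩ = Label.B →
      ∀ p q, (pretzelDiagram a ha).circleSetoid S p q →
      ((p.1.1 = l ∧ ((lo.val < p.1.2.val ∧ p.1.2.val < hi.val) ∨
        (p.1.2.val = lo.val ∧ (p.2 = Corner.sw ∨ p.2 = Corner.se)) ∨
        (p.1.2.val = hi.val ∧ (p.2 = Corner.nw ∨ p.2 = Corner.ne)))) ↔
      (q.1.1 = l ∧ ((lo.val < q.1.2.val ∧ q.1.2.val < hi.val) ∨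
        (q.1.2.val = lo.val ∧ (q.2 = Corner.sw ∨ q.2 = Corner.se)) ∨
        (q.1.2.val = hi.val ∧ (q.2 = Corner.nw ∨ q.2 = Corner.ne))))) := by
    intro lo hi hlt hlo hhi p q h
    have hlt' : lo.val < hi.val := hlt
    refine (pretzelDiagram a ha).mem_iff_of_circleSetoid S
      (fun p => p.1.1 = l ∧ ((lo.val < p.1.2.val ∧ p.1.2.val < hi.val) ∨
        (p.1.2.val = lo.val ∧ (p.2 = Corner.sw ∨ p.2 = Corner.se)) ∨
        (p.1.2.val = hi.val ∧ (p.2 = Corner.nw ∨ p.2 = Corner.ne)))) ?_ ?_ h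
    · rintro ⟨⟨l', r, hr⟩, c⟩ ⟨hl', hp⟩
      obtain rfl : l' = l := hl'
      have h2 := hi.2
      simp only at hp
      change _ ∧ _
      cases c <;> simp only [reduceCtorEq, or_false, false_or, or_true, and_true, and_false,
          or_self] at hp <;>
        simp only [pretzelDiagram, glue]
      · rw [if_neg (by omega)]
        simp; omega
      · rw [if_neg (by omega)]
        simp; omega
      · rw [dif_pos (by omega)]
        simp; omega
      · rw [dif_pos (by omega)]
        simp; omega
    · rintro ⟨⟨l', r, hr⟩, c⟩ ⟨hl', hp⟩
      obtain rfl : l' = l := hl'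
      refine ⟨rfl, ?_⟩
      rcases hp with hp | ⟨hp, hc⟩ | ⟨hp, hc⟩
      · exact Or.inl hp
      · refine Or.inr (Or.inl ⟨hp, ?_⟩)
        obtain rfl : r = lo.val := hp
        rw [smooth_pos_B ha hl hlo]
        rcases hc with hc | hc <;> simp only at hc <;> subst hc <;> simp [Corner.horiz]
      · refine Or.inr (Or.inr ⟨hp, ?_⟩)
        obtain rfl : r = hi.val := hp
        rw [smooth_pos_B ha hl hhi]
        rcases hc with hc | hc <;> simp only at hc <;> subst hc <;> simp [Corner.horiz]
  intro h
  rcases lt_or_gt_of_ne hne with hlt | hlt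
  · have := main k k' hlt hk hk' _ _ h
    have hlt' : k.val < k'.val := hlt
    simp at this
    omega
  · have := main k' k hlt hk' hk _ _ h
    have hlt' : k'.val < k.val := hlt
    simp at this
    omega

theorem val_finRotate {l : Fin n} (h : l.val + 1 < n) : (finRotate n l).val = l.val + 1 := by
  obtain _ | m := n
  · exact l.elim0
  · refine coe_finRotate_of_ne_last fun h' => ?_
    rw [h'] at h
    simp at h

theorem val_finRotate_symm {l : Fin n} (h : 0 < l.val) :
    ((finRotate n).symm l).val = l.val - 1 := by
  have h1 : finRotate n ⟨l.val - 1, by omega⟩ = l := by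
    apply Fin.ext
    rw [val_finRotate (by simp only; omega)]
    simp only
    omega
  rw [Equiv.symm_apply_eq _ |>.2 h1.symm]

/-- Two negative columns with labels `B` cut out a union of circles. -/
theorem separated_of_neg (ha : ∀ l, a l ≠ 0) {S : PretzelCrossing a → Label}
    (hS : ∀ x, a x.1 < 0 → S x = Label.B) {x : PretzelCrossing a} (hx : a x.1 < 0)
    {l : Fin n} (hl : a l < 0) (hne : x.1 ≠ l) : (pretzelDiagram a ha).Separated S x := by
  -- The closed set lies between the two columns: the right ends of `j`, the left ends of `k`, and
  -- all columns in between. Since `j < k`, the cyclic order never wraps around here.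
  have main : ∀ j k : Fin n, j < k → a j < 0 → a k < 0 →
      ∀ p q, (pretzelDiagram a ha).circleSetoid S p q →
      (((j.val < p.1.1.val ∧ p.1.1.val < k.val) ∨
        (p.1.1 = j ∧ (p.2 = Corner.ne ∨ p.2 = Corner.se)) ∨
        (p.1.1 = k ∧ (p.2 = Corner.nw ∨ p.2 = Corner.sw))) ↔
      ((j.val < q.1.1.val ∧ q.1.1.val < k.val) ∨
        (q.1.1 = j ∧ (q.2 = Corner.ne ∨ q.2 = Corner.se)) ∨
        (q.1.1 = k ∧ (q.2 = Corner.nw ∨ q.2 = Corner.sw)))) := by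
    intro j k hjk hj hk p q h
    have hlt : j.val < k.val := hjk
    refine (pretzelDiagram a ha).mem_iff_of_circleSetoid S
      (fun p => (j.val < p.1.1.val ∧ p.1.1.val < k.val) ∨
        (p.1.1 = j ∧ (p.2 = Corner.ne ∨ p.2 = Corner.se)) ∨
        (p.1.1 = k ∧ (p.2 = Corner.nw ∨ p.2 = Corner.sw))) ?_ ?_ h
    · rintro ⟨⟨l, r, hr⟩, c⟩ hp
      have hkn := k.2
      simp only [Fin.ext_iff] at hp ⊢
      cases c <;> simp only [reduceCtorEq, or_false, false_or, or_true, and_true, and_false,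
          or_self] at hp <;>
        simp only [pretzelDiagram, glue]
      · split_ifs
        · have := val_finRotate_symm (l := l) (by omega)
          generalize (finRotate n).symm l = l' at this ⊢
          simp [top]; omega
        · simp; omega
      · split_ifs
        · have := val_finRotate (l := l) (by omega)
          generalize finRotate n l = l' at this ⊢
          simp [top]; omega
        · simp; omega
      · split_ifs
        · simp; omega
        · have := val_finRotate_symm (l := l) (by omega)
          generalize (finRotate n).symm l = l' at this ⊢
          simp [bottom]; omega
      · split_ifs
        · simp; omega
        · have := val_finRotate (l := l) (by omega)
          generalize finRotate n l = l' at this ⊢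
          simp [bottom]; omega
    · rintro ⟨⟨l, r, hr⟩, c⟩ hp
      rcases hp with hp | ⟨hp, hc⟩ | ⟨hp, hc⟩
      · exact Or.inl hp
      · refine Or.inr (Or.inl ⟨hp, ?_⟩)
        obtain rfl : l = j := hp
        rw [smooth_neg_B ha hj (hS _ hj)]
        rcases hc with hc | hc <;> simp only at hc <;> subst hc <;> simp [Corner.vert]
      · refine Or.inr (Or.inr ⟨hp, ?_⟩)
        obtain rfl : l = k := hp
        rw [smooth_neg_B ha hk (hS _ hk)]
        rcases hc with hc | hc <;> simp only at hc <;> subst hc <;> simp [Corner.vert]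
  intro h
  rcases lt_or_gt_of_ne hne with hlt | hlt
  · have := main _ _ hlt hx hl _ _ h
    simp [hne] at this
  · have := main _ _ hlt hl hx _ _ h
    simp [hne] at this

section Outer

variable (ha : ∀ l, a l ≠ 0) {S : PretzelCrossing a → Label}

theorem circleSetoid_top_bottom_of_neg (hS : ∀ x, a x.1 < 0 → S x = Label.B) {l : Fin n}
    (hl : a l < 0) :
    (pretzelDiagram a ha).circleSetoid S (top ha l, Corner.ne) (bottom ha l, Corner.se) := by
  set D := pretzelDiagram a ha
  have tr := @(D.circleSetoid S).trans
  have hm := Int.natAbs_pos.mpr (ha l)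
  have key : ∀ k (hk : k < (a l).natAbs),
      D.circleSetoid S (top ha l, Corner.ne) (⟨l, k, hk⟩, Corner.se) := by
    intro k
    have hs : ∀ hk, D.circleSetoid S (⟨l, k, hk⟩, Corner.ne) (⟨l, k, hk⟩, Corner.se) := by
      intro hk
      have := D.circleSetoid_smooth S (⟨l, k, hk⟩, Corner.ne)
      rwa [smooth_neg_B ha hl (hS _ hl)] at this
    induction k with
    | zero => exact hs
    | succ k ih =>
      intro hk
      have h1 := ih (fun hk => by
        have := D.circleSetoid_smooth S (⟨l, k, hk⟩, Corner.ne)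
        rwa [smooth_neg_B ha hl (hS _ hl)] at this) (by omega)
      have h2 := D.circleSetoid_glue S (⟨l, k, by omega⟩, Corner.se)
      rw [glue_se_of_lt ha l k hk] at h2
      exact tr (tr h1 h2) (hs hk)
  exact key _ _

/-- The left and the right strand run down along vertical `A`-arcs in parallel until the first
`B`-crossing, whose upper arc joins them. -/
theorem circleSetoid_top_of_pos {l : Fin n} (hl : 0 < a l) (hB : ∃ k, S ⟨l, k⟩ = Label.B) :
    (pretzelDiagram a ha).circleSetoid S (top ha l, Corner.nw) (top ha l, Corner.ne) := by
  set D := pretzelDiagram a ha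
  have tr := @(D.circleSetoid S).trans
  have sy := @(D.circleSetoid S).symm
  have key : ∀ k (hk : k < (a l).natAbs),
      D.circleSetoid S (top ha l, Corner.nw) (top ha l, Corner.ne) ∨
      (D.circleSetoid S (top ha l, Corner.nw) (⟨l, k, hk⟩, Corner.nw) ∧
        D.circleSetoid S (top ha l, Corner.ne) (⟨l, k, hk⟩, Corner.ne)) := by
    intro k
    induction k with
    | zero => exact fun _ => Or.inr ⟨(D.circleSetoid S).refl _, (D.circleSetoid S).refl _⟩
    | succ k ih =>
      intro hk
      rcases ih (by omega) with h | ⟨h1, h2⟩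
      · exact Or.inl h
      · have s1 := D.circleSetoid_smooth S (⟨l, k, by omega⟩, Corner.nw)
        have s2 := D.circleSetoid_smooth S (⟨l, k, by omega⟩, Corner.ne)
        have g1 := D.circleSetoid_glue S (⟨l, k, by omega⟩, Corner.sw)
        have g2 := D.circleSetoid_glue S (⟨l, k, by omega⟩, Corner.se)
        rw [glue_sw_of_lt ha l k hk] at g1
        rw [glue_se_of_lt ha l k hk] at g2
        cases hc : S ⟨l, k, by omega⟩
        · rw [smooth_pos_A ha hl hc] at s1 s2
          exact Or.inr ⟨tr h1 (tr s1 g1), tr h2 (tr s2 g2)⟩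
        · rw [smooth_pos_B ha hl hc] at s1
          exact Or.inl (tr h1 (tr s1 (sy h2)))
  obtain ⟨k, hkB⟩ := hB
  rcases key k k.2 with h | ⟨h1, h2⟩
  · exact h
  · have s1 := D.circleSetoid_smooth S (⟨l, k⟩, Corner.nw)
    rw [smooth_pos_B ha hl hkB] at s1
    exact tr h1 (tr s1 (sy h2))

theorem circleSetoid_bottom_of_pos {l : Fin n} (hl : 0 < a l) (hB : ∃ k, S ⟨l, k⟩ = Label.B) :
    (pretzelDiagram a ha).circleSetoid S (bottom ha l, Corner.sw) (bottom ha l, Corner.se) := by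
  set D := pretzelDiagram a ha
  have tr := @(D.circleSetoid S).trans
  have sy := @(D.circleSetoid S).symm
  -- The same descent upside down; `d` is the distance of the row `k` from the last row.
  have key : ∀ d k (hk : k < (a l).natAbs), k + d + 1 = (a l).natAbs →
      D.circleSetoid S (bottom ha l, Corner.sw) (bottom ha l, Corner.se) ∨
      (D.circleSetoid S (bottom ha l, Corner.sw) (⟨l, k, hk⟩, Corner.sw) ∧
        D.circleSetoid S (bottom ha l, Corner.se) (⟨l, k, hk⟩, Corner.se)) := by
    intro d
    induction d with
    | zero =>
      intro k hk h
      obtain rfl : k = (a l).natAbs - 1 := by omega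
      exact Or.inr ⟨(D.circleSetoid S).refl _, (D.circleSetoid S).refl _⟩
    | succ d ih =>
      intro k hk hkd
      have hk' : k + 1 < (a l).natAbs := by omega
      rcases ih (k + 1) hk' (by omega) with h | ⟨h1, h2⟩
      · exact Or.inl h
      · have s1 := D.circleSetoid_smooth S (⟨l, k + 1, hk'⟩, Corner.sw)
        have s2 := D.circleSetoid_smooth S (⟨l, k + 1, hk'⟩, Corner.se)
        have g1 := D.circleSetoid_glue S (⟨l, k, by omega⟩, Corner.sw)
        have g2 := D.circleSetoid_glue S (⟨l, k, by omega⟩, Corner.se)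
        rw [glue_sw_of_lt ha l k hk'] at g1
        rw [glue_se_of_lt ha l k hk'] at g2
        cases hc : S ⟨l, k + 1, hk'⟩
        · rw [smooth_pos_A ha hl hc] at s1 s2
          exact Or.inr ⟨tr h1 (tr s1 (sy g1)), tr h2 (tr s2 (sy g2))⟩
        · rw [smooth_pos_B ha hl hc] at s1
          exact Or.inl (tr h1 (tr s1 (sy h2)))
  obtain ⟨k, hkB⟩ := hB
  rcases key ((a l).natAbs - 1 - k.val) k k.2 (by omega) with h | ⟨h1, h2⟩
  · exact h
  · have s1 := D.circleSetoid_smooth S (⟨l, k⟩, Corner.sw)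
    rw [smooth_pos_B ha hl hkB] at s1
    exact tr h1 (tr s1 (sy h2))

theorem forall_of_finRotate {P : Fin n → Prop} {j : Fin n} (hj : P j)
    (h : ∀ l, P l → P (finRotate n l)) (l : Fin n) : P l := by
  have hn : 0 < n := l.pos
  have key : ∀ k (l : Fin n), l.val = (j.val + k) % n → P l := by
    intro k
    induction k with
    | zero =>
      intro l hl
      rw [Nat.add_zero, Nat.mod_eq_of_lt j.2] at hl
      rwa [Fin.ext hl]
    | succ k ih =>
      intro l hl
      have hlt := Nat.mod_lt (j.val + k) hn
      have h1 := h _ (ih ⟨(j.val + k) % n, hlt⟩ rfl)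
      have h2 : finRotate n ⟨(j.val + k) % n, hlt⟩ = l := by
        apply Fin.ext
        rw [hl, ← Nat.add_assoc, Nat.add_mod (j.val + k) 1 n]
        obtain _ | _ | m := n
        · omega
        · omega
        · rw [finRotate_apply, Fin.val_add]
          simp
      rwa [h2] at h1
  refine key (n - j.val + l.val) l ?_
  rw [← Nat.add_assoc, Nat.add_sub_of_le j.2.le, Nat.add_mod_left, Nat.mod_eq_of_lt l.2]

/-- The upper and the lower left end of a column lie on the same circle. -/
theorem circleSetoid_outer (hS : ∀ x, a x.1 < 0 → S x = Label.B)
    (hB : ∀ l, 0 < a l → ∃ k, S ⟨l, k⟩ = Label.B) (hneg : ∃ j, a j < 0) (l : Fin n) :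
    (pretzelDiagram a ha).circleSetoid S (top ha l, Corner.nw) (bottom ha l, Corner.sw) := by
  set D := pretzelDiagram a ha
  have tr := @(D.circleSetoid S).trans
  have sy := @(D.circleSetoid S).symm
  have step : ∀ l, D.circleSetoid S (top ha l, Corner.ne) (bottom ha l, Corner.se) →
      D.circleSetoid S (top ha (finRotate n l), Corner.nw)
        (bottom ha (finRotate n l), Corner.sw) := by
    intro l h
    have g1 := D.circleSetoid_glue S (top ha l, Corner.ne)
    have g2 := D.circleSetoid_glue S (bottom ha l, Corner.se)
    have e1 : D.glue (top ha l, Corner.ne) = (top ha (finRotate n l), Corner.nw) :=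
      glue_top_ne ha l
    have e2 : D.glue (bottom ha l, Corner.se) = (bottom ha (finRotate n l), Corner.sw) :=
      glue_bottom_se ha l
    rw [e1] at g1
    rw [e2] at g2
    exact tr (sy g1) (tr h g2)
  obtain ⟨j, hj⟩ := hneg
  -- The right side of a negative column joins top and bottom. This passes to the next column, and
  -- each column transmits it from left to right: a positive one by its upper and lower caps, a
  -- negative one by its own right side.
  refine forall_of_finRotate (P := fun l => D.circleSetoid S (top ha l, Corner.nw)
    (bottom ha l, Corner.sw)) (step j (circleSetoid_top_bottom_of_neg ha hS hj)) ?_ l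
  intro l h
  refine step l ?_
  rcases lt_or_gt_of_ne (ha l) with hl | hl
  · exact circleSetoid_top_bottom_of_neg ha hS hl
  · exact tr (sy (circleSetoid_top_of_pos ha hl (hB l hl)))
      (tr h (circleSetoid_bottom_of_pos ha hl (hB l hl)))

end Outer

end PretzelCrossing

/-! ### Label counts, telescoping in a column, and the differential of the counted chains -/

namespace PretzelCrossing

variable {n : ℕ} {a : Fin n → ℤ}

open LinkDiagram

/-- The number of crossings with label `B` in the column `l`. -/
def count (S : PretzelCrossing a → Label) (l : Fin n) : ℕ :=
  (Finset.univ.filter fun k => S ⟨l, k⟩ = Label.B).card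

/-- The number of crossings with label `B` among the first `k` crossings of the column `l`. -/
def countAbove (S : PretzelCrossing a → Label) (l : Fin n) (k : ℕ) : ℕ :=
  (Finset.univ.filter fun k' : Fin (a l).natAbs => k'.val < k ∧ S ⟨l, k'⟩ = Label.B).card

theorem count_le (S : PretzelCrossing a → Label) (l : Fin n) : count S l ≤ (a l).natAbs :=
  (Finset.card_le_univ _).trans_eq (Fintype.card_fin _)

theorem eq_B_of_count_eq {S : PretzelCrossing a → Label} {l : Fin n}
    (h : count S l = (a l).natAbs) (k : Fin (a l).natAbs) : S ⟨l, k⟩ = Label.B := by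
  have := (Finset.card_eq_iff_eq_univ _).1 (h.trans (Fintype.card_fin _).symm)
  have hk := Finset.mem_univ k
  rw [← this] at hk
  exact (Finset.mem_filter.1 hk).2

theorem exists_eq_B_of_count_pos {S : PretzelCrossing a → Label} {l : Fin n}
    (h : 1 ≤ count S l) : ∃ k, S ⟨l, k⟩ = Label.B := by
  obtain ⟨k, hk⟩ := Finset.card_pos.1 (Nat.lt_of_lt_of_le Nat.one_pos h)
  exact ⟨k, (Finset.mem_filter.1 hk).2⟩

theorem exists_ne_eq_B_of_two_le_count {S : PretzelCrossing a → Label} {l : Fin n}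
    (h : 2 ≤ count S l) (k : Fin (a l).natAbs) : ∃ k', k ≠ k' ∧ S ⟨l, k'⟩ = Label.B := by
  have h' : 1 < (Finset.univ.filter fun k => S ⟨l, k⟩ = Label.B).card := h
  obtain ⟨k', hk', hne⟩ := Finset.exists_mem_ne h' k
  exact ⟨k', hne.symm, (Finset.mem_filter.1 hk').2⟩

theorem count_eq_add_one {S S' : PretzelCrossing a → Label} {l : Fin n} {k : Fin (a l).natAbs}
    (hst : ∀ y, y ≠ ⟨l, k⟩ → S' y = S y) (hs : S ⟨l, k⟩ = Label.A) (ht : S' ⟨l, k⟩ = Label.B) :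
    count S' l = count S l + 1 := by
  unfold count
  rw [← Finset.card_insert_of_notMem (a := k) (by simp [hs])]
  congr 1
  ext k'
  by_cases h : k' = k
  · simp [h, ht]
  · simp [h, hst ⟨l, k'⟩ (by simpa using h)]

theorem count_congr {S S' : PretzelCrossing a → Label} {l l' : Fin n} {k : Fin (a l).natAbs}
    (hst : ∀ y, y ≠ ⟨l, k⟩ → S' y = S y) (h : l' ≠ l) : count S' l' = count S l' := by
  unfold count
  congr 1
  ext k'
  simp only [Finset.mem_filter]
  rw [hst ⟨l', k'⟩ (fun h' => h (congrArg Sigma.fst h'))]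

theorem countAbove_congr {S S' : PretzelCrossing a → Label} {l : Fin n} {k : Fin (a l).natAbs}
    (hst : ∀ y, y ≠ ⟨l, k⟩ → S' y = S y) : countAbove S' l k = countAbove S l k := by
  unfold countAbove
  congr 1
  ext k'
  by_cases h : k' = k
  · simp [h]
  · simp only [Finset.mem_filter]
    rw [hst ⟨l, k'⟩ (by simpa using h)]

/-- The order of the crossings column by column, and from top to bottom within a column. -/
def Before (x y : PretzelCrossing a) : Prop :=
  x.1 < y.1 ∨ (x.1 = y.1 ∧ x.2.val < y.2.val)

theorem before_iff (x y : PretzelCrossing a) (h : x ≠ y) : Before x y ↔ ¬ Before y x := by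
  obtain ⟨l, k⟩ := x
  obtain ⟨l', k'⟩ := y
  unfold Before
  by_cases hl : l = l'
  · subst hl
    have hk : k.val ≠ k'.val := fun h' => h (by rw [Fin.ext h'])
    simp; omega
  · have : l.val ≠ l'.val := fun h' => hl (Fin.ext h')
    simp [hl, Ne.symm hl]; omega

/-- In the column order the exponent of the incidence sign has a part that depends only on the label
counts and a part that alternates down the column; the latter makes the column sum telescope. -/
theorem card_before (S : PretzelCrossing a → Label) (l : Fin n) (k : Fin (a l).natAbs) :
    Nat.card {y : PretzelCrossing a // Before y ⟨l, k⟩ ∧ S y = Label.B} =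
      (∑ l' with l' < l, count S l') + countAbove S l k := by
  classical
  rw [Nat.card_eq_fintype_card, Fintype.card_subtype, Finset.card_filter, Fintype.sum_sigma]
  have : countAbove S l k = ∑ l', if l' = l then countAbove S l' k else 0 := by simp
  rw [this, Finset.sum_filter, ← Finset.sum_add_distrib]
  refine Finset.sum_congr rfl fun l' _ => ?_
  rcases lt_trichotomy l' l with h | rfl | h
  · simp [Before, h, h.ne, count]
  · simp [Before, countAbove]
  · simp [Before, h.not_gt, h.ne']

theorem sum_count_eq_card (S : PretzelCrossing a → Label) :
    Nat.card {x : PretzelCrossing a // S x = Label.B} = ∑ l, count S l := by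
  classical
  rw [Nat.card_eq_fintype_card, Fintype.card_subtype, Finset.card_filter, Fintype.sum_sigma]
  exact Finset.sum_congr rfl fun l _ => by simp [count]

/-- Telescoping down a column. -/
theorem sum_column (ha : ∀ l, a l ≠ 0) {S : PretzelCrossing a → Label} {l : Fin n} (hl : 0 < a l)
    (hout : (pretzelDiagram a ha).circleSetoid S (top ha l, Corner.nw) (bottom ha l, Corner.sw))
    (f : (pretzelDiagram a ha).Circle S → ℤ) :
    (∑ k : Fin (a l).natAbs, if S ⟨l, k⟩ = Label.B then (-1) ^ countAbove S l k *
      (f ((pretzelDiagram a ha).circleThrough S (⟨l, k⟩, Corner.nw)) +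
        f ((pretzelDiagram a ha).circleThrough S (⟨l, k⟩, Corner.se))) else 0) =
      (1 - (-1) ^ count S l) * f ((pretzelDiagram a ha).circleThrough S (top ha l, Corner.nw)) := by
  revert f
  set D := pretzelDiagram a ha with hD
  intro f
  have hm := Int.natAbs_pos.mpr (ha l)
  -- `pos k` is the left end just above row `k`; the value past the last row is the lower left end
  -- of the column, which closes the telescope.
  let pos : ℕ → PretzelCrossing a × Corner := fun k =>
    if h : k < (a l).natAbs then (⟨l, k, h⟩, Corner.nw) else (bottom ha l, Corner.sw)
  let g : ℕ → ℤ := fun k => (-1) ^ countAbove S l k * f (D.circleThrough S (pos k))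
  have hstep : ∀ k : Fin (a l).natAbs,
      D.circleThrough S (⟨l, k⟩, Corner.sw) = D.circleThrough S (pos (k.val + 1)) := by
    intro k
    simp only [pos]
    split_ifs with h
    · rw [D.circleThrough_eq_iff]
      have := D.circleSetoid_glue S (⟨l, k⟩, Corner.sw)
      rwa [glue_sw_of_lt ha l k h] at this
    · congr 2
      have hk := k.2
      have : k = ⟨(a l).natAbs - 1, by omega⟩ := Fin.ext (by simp only; omega)
      rw [this]
      rfl
  have hpos : ∀ k : Fin (a l).natAbs, pos k.val = (⟨l, k⟩, Corner.nw) := by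
    intro k
    simp [pos, k.2]
  have hterm : ∀ k : Fin (a l).natAbs, (if S ⟨l, k⟩ = Label.B then (-1) ^ countAbove S l k *
      (f (D.circleThrough S (⟨l, k⟩, Corner.nw)) +
        f (D.circleThrough S (⟨l, k⟩, Corner.se))) else 0) = g k.val - g (k.val + 1) := by
    intro k
    simp only [g, hpos, ← hstep]
    -- At an `A` the left arc is vertical, so neither the circle on the left nor the count changes.
    -- At a `B` the count grows by one, and the circle through `se` is the one through `sw`.
    cases hk : S ⟨l, k⟩
    · have h1 : D.circleThrough S (⟨l, k⟩, Corner.nw) = D.circleThrough S (⟨l, k⟩, Corner.sw) := by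
        rw [D.circleThrough_eq_iff]
        have := D.circleSetoid_smooth S (⟨l, k⟩, Corner.nw)
        rwa [smooth_pos_A ha hl hk] at this
      have h2 : countAbove S l (k.val + 1) = countAbove S l k.val := by
        unfold countAbove
        congr 1
        ext k'
        by_cases h : k' = k
        · simp [h, hk]
        · have : k'.val ≠ k.val := fun h' => h (Fin.ext h')
          simp only [Finset.mem_filter, Finset.mem_univ, true_and]
          refine and_congr_left fun _ => ?_
          omega
      rw [h1, h2]
      simp
    · have h1 : D.circleThrough S (⟨l, k⟩, Corner.se) = D.circleThrough S (⟨l, k⟩, Corner.sw) := by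
        rw [D.circleThrough_eq_iff]
        have := D.circleSetoid_smooth S (⟨l, k⟩, Corner.se)
        rwa [smooth_pos_B ha hl hk] at this
      have h2 : countAbove S l (k.val + 1) = countAbove S l k.val + 1 := by
        unfold countAbove
        rw [← Finset.card_insert_of_notMem (a := k) (by simp)]
        congr 1
        ext k'
        by_cases h : k' = k
        · simp [h, hk]
        · have : k'.val ≠ k.val := fun h' => h (Fin.ext h')
          simp only [Finset.mem_filter, Finset.mem_univ, true_and, Finset.mem_insert, h, false_or]
          refine and_congr_left fun _ => ?_
          omega
      rw [h1, h2]
      simp only [if_true]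
      ring
  rw [Finset.sum_congr rfl fun k _ => hterm k,
    Fin.sum_univ_eq_sum_range (fun k => g k - g (k + 1)), Finset.sum_range_sub']
  have h0 : countAbove S l 0 = 0 := by simp [countAbove]
  have h1 : countAbove S l (a l).natAbs = count S l := by simp [countAbove, count]
  have h2 : pos 0 = (top ha l, Corner.nw) := by simp [pos, hm]; rfl
  have h3 : pos (a l).natAbs = (bottom ha l, Corner.sw) := by simp [pos]
  simp only [g, h0, h1, h2, h3]
  rw [← (D.circleThrough_eq_iff _ _ _).2 hout]
  ring

/-- The numbers of `B`-labels in the columns are given by `T`. -/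
def HasCount (S : PretzelCrossing a → Label) (T : Fin n → ℕ) : Prop := ∀ l, count S l = T l

/-- Every crossing in a negative column and some crossing in every positive column has the
label `B`. -/
structure Full (a : Fin n → ℤ) (T : Fin n → ℕ) : Prop where
  neg : ∀ l, a l < 0 → T l = (a l).natAbs
  pos : ∀ l, 0 < a l → 1 ≤ T l

theorem HasCount.eq_B {S : PretzelCrossing a → Label} {T : Fin n → ℕ} (h : HasCount S T)
    (hT : Full a T) (x : PretzelCrossing a) (hx : a x.1 < 0) : S x = Label.B :=
  eq_B_of_count_eq ((h x.1).trans (hT.neg _ hx)) x.2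

theorem HasCount.circleSetoid_outer (ha : ∀ l, a l ≠ 0) {S : PretzelCrossing a → Label}
    {T : Fin n → ℕ} (h : HasCount S T) (hT : Full a T) (hneg : ∃ j, a j < 0) (l : Fin n) :
    (pretzelDiagram a ha).circleSetoid S (top ha l, Corner.nw) (bottom ha l, Corner.sw) :=
  PretzelCrossing.circleSetoid_outer ha (h.eq_B hT)
    (fun l hl => exists_eq_B_of_count_pos ((hT.pos l hl).trans_eq (h l).symm)) hneg l

/-- A `B`-crossing is separated by a partner: a second `B` in its positive column, or a second
negative column. This is where two negative columns are needed rather than one. -/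
theorem HasCount.separated (ha : ∀ l, a l ≠ 0) (hneg : ∃ j k, j ≠ k ∧ a j < 0 ∧ a k < 0)
    {S : PretzelCrossing a → Label} {T : Fin n → ℕ} (h : HasCount S T)
    (hT : Full a T) {x : PretzelCrossing a} (hx : S x = Label.B) (h2 : 0 < a x.1 → 2 ≤ T x.1) :
    (pretzelDiagram a ha).Separated S x := by
  rcases lt_or_gt_of_ne (ha x.1) with hl | hl
  · obtain ⟨j, k, hjk, hj, hk⟩ := hneg
    by_cases hxj : x.1 = j
    · exact separated_of_neg ha (h.eq_B hT) hl hk (hxj ▸ hjk)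
    · exact separated_of_neg ha (h.eq_B hT) hl hj hxj
  · obtain ⟨k', hne, hk'⟩ := exists_ne_eq_B_of_two_le_count ((h2 hl).trans_eq (h _).symm) x.2
    exact separated_of_pos ha hl hne hx hk'

theorem HasCount.update {S S' : PretzelCrossing a → Label} {T : Fin n → ℕ} {l : Fin n}
    {k : Fin (a l).natAbs} (hst : ∀ y, y ≠ ⟨l, k⟩ → S' y = S y) (hs : S ⟨l, k⟩ = Label.A)
    (ht : S' ⟨l, k⟩ = Label.B) : HasCount S T ↔ HasCount S' (Function.update T l (T l + 1)) := by
  refine forall_congr' fun l' => ?_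
  by_cases h : l' = l
  · subst h
    rw [count_eq_add_one hst hs ht, Function.update_self]
    omega
  · rw [count_congr hst h, Function.update_of_ne h]

theorem Full.update {T : Fin n → ℕ} (hT : Full a T) {l : Fin n} (hl : 0 < a l) :
    Full a (Function.update T l (T l + 1)) where
  neg l' hl' := by
    rw [Function.update_of_ne (by rintro rfl; omega)]
    exact hT.neg _ hl'
  pos l' hl' := by
    by_cases h : l' = l
    · subst h; simp
    · rw [Function.update_of_ne h]; exact hT.pos _ hl'

section Chain

variable (ha : ∀ l, a l ≠ 0) (num : PretzelCrossing a ↪ ℕ)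

open Classical in
/-- The signed sum of the states whose labels are counted by `T` and whose negative circles are
those through the ends in `base`. -/
noncomputable def countChain (i j : ℤ) (base : Set (PretzelCrossing a × Corner)) (T : Fin n → ℕ) :
    (pretzelDiagram a ha).Chain i j :=
  (pretzelDiagram a ha).sectionChain i j ((pretzelDiagram a ha).baseSigns base)
    fun S => if HasCount S T then sortSign Before num S else 0

open Classical in
-- In column order, all predecessors of `t` obtained by removing a `B` from column `l` carry a
-- common sign times an alternating one. Each contributes the `extraMinus` values of its two
-- circles, and `sum_column` collapses the result to the outer circle.
theorem differential_countChain (hneg : ∃ j k, j ≠ k ∧ a j < 0 ∧ a k < 0) {i i' j : ℤ}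
    {base : Set (PretzelCrossing a × Corner)} (hbase : base.Subsingleton) {T : Fin n → ℕ}
    (hT : Full a T)
    (hdeg : ∀ S, HasCount S T → (pretzelDiagram a ha).homDegree
      ⟨S, (pretzelDiagram a ha).baseSigns base S⟩ = i ∧ (pretzelDiagram a ha).quantumDegree
      ⟨S, (pretzelDiagram a ha).baseSigns base S⟩ = j)
    (t : (pretzelDiagram a ha).StatesOfDegree i' j) :
    (pretzelDiagram a ha).differential num i i' j (countChain ha num i j base T) t =
      ∑ l, if HasCount t.1.1 (Function.update T l (T l + 1)) then
        sortSign Before num t.1.1 * (-1) ^ (∑ l' with l' < l, T l') * ((1 + (-1) ^ T l) *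
          (pretzelDiagram a ha).extraMinus base t.1.2
            ((pretzelDiagram a ha).circleThrough t.1.1 (top ha l, Corner.nw))) else 0 := by
  obtain ⟨⟨S', τ⟩, ht⟩ := t
  unfold countChain
  rw [differential_sectionChain_apply _ _ _ _ _ _ _ (fun S hS => hdeg S (by
    by_contra h; exact hS (if_neg h))), Fintype.sum_sigma]
  refine Finset.sum_congr rfl fun l _ => ?_
  dsimp only
  have hupd : ∀ k, S' ⟨l, k⟩ = Label.B →
      (HasCount (Function.update S' ⟨l, k⟩ Label.A) T ↔
        HasCount S' (Function.update T l (T l + 1))) := fun k hk =>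
    HasCount.update (fun y hy => by simp [hy]) (by simp) hk
  split_ifs with hc
  · have hl : 0 < a l := by
      rcases lt_or_gt_of_ne (ha l) with hl | hl
      · have h1 := hc l
        rw [Function.update_self, hT.neg l hl] at h1
        have h2 := count_le S' l
        omega
      · exact hl
    have hT' := hT.update hl
    have hcol := sum_column ha hl (hc.circleSetoid_outer ha hT' (by
      obtain ⟨j, -, -, hj, -⟩ := hneg; exact ⟨j, hj⟩) l) ((pretzelDiagram a ha).extraMinus base τ)
    rw [hc l, Function.update_self] at hcol
    have : (1 + (-1) ^ T l : ℤ) = 1 - (-1) ^ (T l + 1) := by ring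
    rw [this, ← hcol, Finset.mul_sum]
    refine Finset.sum_congr rfl fun k _ => ?_
    cases hk : S' ⟨l, k⟩
    · rw [if_neg, if_neg (by decide), mul_zero]
      intro h
      exact absurd (hk.symm.trans h.2.1) (by decide)
    · have hst : ∀ y, y ≠ ⟨l, k⟩ → S' y = Function.update S' ⟨l, k⟩ Label.A y :=
        fun y hy => by simp [hy]
      have hcS := (hupd k hk).2 hc
      have hsep : (pretzelDiagram a ha).Separated S' ⟨l, k⟩ := hc.separated ha hneg hT' hk (fun _ => by
        have := hT.pos l hl
        simp only [Function.update_self]; omega)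
      have hadj := (pretzelDiagram a ha).adjacentAt_baseSigns hbase τ hst (by simp) hk hsep
      have hsgn := sortSign_mul_neg_one_pow before_iff num.injective hst (by simp) hk
      rw [card_before, ← countAbove_congr hst,
        Finset.sum_congr rfl (fun l' _ => hcS l')] at hsgn
      rw [if_pos hcS, hsgn, if_pos rfl, ← hadj, pow_add]
      split_ifs <;> ring
  · refine Finset.sum_eq_zero fun k _ => ?_
    split_ifs with hadj hcS
    · exact absurd ((hupd k hadj.2.1).1 hcS) hc
    · simp
    · rfl

end Chain

/-! ### Degrees of the states with given label counts -/

section Degree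

variable (ha : ∀ l, a l ≠ 0)

/-- The difference of the number of circles and the number of crossings for the all-`B` state. -/
noncomputable def excess : ℤ :=
  (Fintype.card ((pretzelDiagram a ha).Circle fun _ => Label.B) : ℤ) - ∑ l, ((a l).natAbs : ℤ)

/-- Each further `B` splits a circle, so the number of circles minus the number of `B`-labels stays
constant up to the all-`B` state. Hence the quantum degree of the chosen states depends on `T` only.
-/
theorem card_circle (hneg : ∃ j k, j ≠ k ∧ a j < 0 ∧ a k < 0) {S : PretzelCrossing a → Label}
    {T : Fin n → ℕ} (h : HasCount S T) (hT : Full a T) :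
    (Fintype.card ((pretzelDiagram a ha).Circle S) : ℤ) = ∑ l, (T l : ℤ) + excess ha := by
  classical
  obtain ⟨m, hm⟩ : ∃ m, (Finset.univ.filter fun x => S x = Label.A).card = m := ⟨_, rfl⟩
  induction m generalizing S T with
  | zero =>
    rw [Finset.card_eq_zero, Finset.filter_eq_empty_iff] at hm
    have hS : S = fun _ => Label.B := by
      funext x
      have := hm (Finset.mem_univ x)
      cases hx : S x
      · exact absurd hx this
      · rfl
    subst hS
    have : ∀ l, T l = (a l).natAbs := fun l => by rw [← h l]; simp [count]
    simp [excess, this]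
  | succ m ih =>
    obtain ⟨⟨l, k⟩, hx⟩ : (Finset.univ.filter fun x => S x = Label.A).Nonempty := by
      rw [← Finset.card_pos, hm]; omega
    have hx' := (Finset.mem_filter.1 hx).2
    have hl : 0 < a l := by
      rcases lt_or_gt_of_ne (ha l) with hl | hl
      · have := h.eq_B hT ⟨l, k⟩ hl
        rw [hx'] at this
        exact absurd this (by decide)
      · exact hl
    have hst : ∀ y, y ≠ ⟨l, k⟩ → Function.update S ⟨l, k⟩ Label.B y = S y :=
      fun y hy => by simp [hy]
    have hB : Function.update S ⟨l, k⟩ Label.B ⟨l, k⟩ = Label.B := by simp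
    have hc := (HasCount.update hst hx' hB).1 h
    have hT' := hT.update hl
    have hsep := hc.separated ha hneg hT' hB (fun _ => by
      have := hT.pos l hl
      simp only [Function.update_self]; omega)
    have hcard := (pretzelDiagram a ha).card_circle_of_separated hst
      (by rw [hx', hB]; decide) hsep
    have hm' : (Finset.univ.filter fun x => Function.update S ⟨l, k⟩ Label.B x = Label.A).card
        = m := by
      have : (Finset.univ.filter fun x => Function.update S ⟨l, k⟩ Label.B x = Label.A) =
          (Finset.univ.filter fun x => S x = Label.A).erase ⟨l, k⟩ := by
        ext y
        by_cases hy : y = ⟨l, k⟩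
        · simp [hy]
        · simp [hy]
      rw [this, Finset.card_erase_of_mem hx, hm]
      rfl
    have := ih hc hT' hm'
    rw [hcard] at this
    have hsum : ∑ l', (Function.update T l (T l + 1) l' : ℤ) = ∑ l', (T l' : ℤ) + 1 := by
      have h1 := Finset.sum_update_of_mem (Finset.mem_univ l) T (T l + 1)
      have h2 := Finset.add_sum_erase Finset.univ T (Finset.mem_univ l)
      rw [Finset.sdiff_singleton_eq_erase] at h1
      have h3 : ∑ l', Function.update T l (T l + 1) l' = ∑ l', T l' + 1 := by omega
      exact_mod_cast h3
    rw [hsum] at this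
    linarith

theorem homDegree_eq {S : PretzelCrossing a → Label} {T : Fin n → ℕ} (h : HasCount S T)
    (τ : (pretzelDiagram a ha).Circle S → ℤˣ) :
    (pretzelDiagram a ha).homDegree ⟨S, τ⟩ = ∑ l, (T l : ℤ) := by
  unfold homDegree
  simp only
  rw [sum_count_eq_card, Finset.sum_congr rfl fun l _ => h l]
  push_cast
  rfl

theorem quantumDegree_baseSigns_empty (hneg : ∃ j k, j ≠ k ∧ a j < 0 ∧ a k < 0)
    {S : PretzelCrossing a → Label} {T : Fin n → ℕ} (h : HasCount S T) (hT : Full a T) :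
    (pretzelDiagram a ha).quantumDegree ⟨S, (pretzelDiagram a ha).baseSigns ∅ S⟩ =
      2 * ∑ l, (T l : ℤ) + excess ha := by
  unfold quantumDegree
  rw [homDegree_eq ha h, theta_eq_sum]
  have := card_circle ha hneg h hT
  simp [baseSigns, MeetsBase]
  linarith

theorem baseSigns_singleton {X : Type} (D : LinkDiagram X) (p : X × Corner) (S : X → Label) :
    D.baseSigns {p} S = D.minusAt (D.circleThrough S p) := by
  funext C
  by_cases h : C = D.circleThrough S p
  · rw [h, minusAt_self]
    exact if_pos ⟨p, rfl, rfl⟩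
  · rw [D.minusAt_of_ne h]
    exact if_neg (by simpa [MeetsBase] using h)

theorem quantumDegree_baseSigns_singleton (hneg : ∃ j k, j ≠ k ∧ a j < 0 ∧ a k < 0)
    {S : PretzelCrossing a → Label} {T : Fin n → ℕ} (h : HasCount S T) (hT : Full a T)
    (p : PretzelCrossing a × Corner) :
    (pretzelDiagram a ha).quantumDegree ⟨S, (pretzelDiagram a ha).baseSigns {p} S⟩ =
      2 * ∑ l, (T l : ℤ) + excess ha - 2 := by
  classical
  unfold quantumDegree
  rw [homDegree_eq ha h, theta_eq_sum]
  simp only [baseSigns_singleton]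
  have := card_circle ha hneg h hT
  have hsum : ∀ C₀ : (pretzelDiagram a ha).Circle S,
      ∑ C, (((pretzelDiagram a ha).minusAt C₀ C : ℤˣ) : ℤ) =
      Fintype.card ((pretzelDiagram a ha).Circle S) - 2 := by
    intro C₀
    have h1 : ∀ C, (((pretzelDiagram a ha).minusAt C₀ C : ℤˣ) : ℤ) =
        1 - if C = C₀ then 2 else 0 := by
      intro C
      unfold minusAt
      split_ifs <;> simp
    simp [h1, Finset.sum_sub_distrib]
  rw [hsum]
  linarith

end Degree

end PretzelCrossing

/-! ### The torsion cycles and the subgroups generated by them -/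

open Classical in
theorem LinkDiagram.extraMinus_empty {X : Type} (D : LinkDiagram X) {S : X → Label}
    (τ : D.Circle S → ℤˣ) (C : D.Circle S) :
    D.extraMinus ∅ τ C = if τ = D.minusAt C then 1 else 0 := by
  have h : (¬ D.MeetsBase ∅ C ∧ ∀ C', τ C' = -1 ↔ (C' = C ∨ D.MeetsBase ∅ C')) ↔
      τ = D.minusAt C := by
    simp only [MeetsBase, Set.mem_empty_iff_false, false_and, exists_false, not_false_iff,
      or_false, true_and]
    constructor
    · intro h
      funext C'
      by_cases hC : C' = C
      · rw [(h C').2 hC, hC, minusAt_self]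
      · rw [D.minusAt_of_ne hC]
        by_contra h'
        exact hC ((h C').1 ((units_eq_neg_one_iff _).2 h'))
    · rintro rfl C'
      by_cases hC : C' = C
      · simp [hC, minusAt_self]
      · simp only [D.minusAt_of_ne hC, hC, iff_false]; decide
  unfold extraMinus
  split_ifs <;> tauto

/-- The subgroup `H` of the homology contains a class that is not annihilated by `oneMinus S`. -/
def LinkDiagram.Detects {X : Type} [Fintype X] (D : LinkDiagram X) (num : X ↪ ℕ) (S : X → Label)
    {i j : ℤ} (H : AddSubgroup (D.DiagramHomology num i j)) : Prop :=
  ∃ z, D.homologyClass num i j z ∈ H ∧ D.oneMinus i j S z.1 ≠ 0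

namespace PretzelCrossing

variable {n : ℕ} {a : Fin n → ℤ}

open LinkDiagram

/-- The label counts for which the columns carry torsion classes or top degree classes, with a
torsion class in some column. -/
structure Admissible (a : Fin n → ℤ) (T : Fin n → ℕ) : Prop where
  neg : ∀ l, a l < 0 → T l = (a l).natAbs
  two_le : ∀ l, 0 < a l → 2 ≤ T l
  le : ∀ l, T l ≤ (a l).natAbs
  odd : ∀ l, T l < (a l).natAbs → Odd (T l)
  exists_lt : ∃ l, T l < (a l).natAbs

theorem Admissible.full {T : Fin n → ℕ} (hT : Admissible a T) : Full a T :=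
  ⟨hT.neg, fun l hl => (hT.two_le l hl).trans' one_le_two⟩

/-- The state whose labels `B` are the first `T l` crossings of every column `l`. -/
def initialState (a : Fin n → ℤ) (T : Fin n → ℕ) : PretzelCrossing a → Label :=
  fun x => if x.2.val < T x.1 then Label.B else Label.A

theorem hasCount_initialState {T : Fin n → ℕ} (hT : ∀ l, T l ≤ (a l).natAbs) :
    HasCount (initialState a T) T := by
  intro l
  unfold count initialState
  have : (Finset.univ.filter fun k : Fin (a l).natAbs =>
      (if k.val < T l then Label.B else Label.A) = Label.B) =
      Finset.univ.filter fun k : Fin (a l).natAbs => k.val < T l := by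
    ext k
    simp
  rw [this, Fin.card_filter_val_lt, min_eq_right (hT l)]

theorem HasCount.unique {S : PretzelCrossing a → Label} {T T' : Fin n → ℕ} (h : HasCount S T)
    (h' : HasCount S T') : T = T' :=
  funext fun l => (h l).symm.trans (h' l)

theorem Admissible.separated (ha : ∀ l, a l ≠ 0) (hneg : ∃ j k, j ≠ k ∧ a j < 0 ∧ a k < 0)
    {T : Fin n → ℕ} (hT : Admissible a T) (x : PretzelCrossing a)
    (hx : initialState a T x = Label.B) :
    (pretzelDiagram a ha).Separated (initialState a T) x :=
  (hasCount_initialState hT.le).separated ha hneg hT.full hx (hT.two_le _)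

variable (ha : ∀ l, a l ≠ 0) (num : PretzelCrossing a ↪ ℕ)

/-- The torsion class for an admissible label count: a cycle that is not a boundary, but whose
double is one. -/
theorem exists_torsion_cycle (hneg : ∃ j k, j ≠ k ∧ a j < 0 ∧ a k < 0) {T : Fin n → ℕ}
    (hT : Admissible a T) {i j : ℤ} (hi : i = ∑ l, (T l : ℤ))
    (hj : j = 2 * ∑ l, (T l : ℤ) + excess ha - 2) :
    ∃ (z : LinearMap.ker ((pretzelDiagram a ha).differential num i (i + 1) j))
      (w : (pretzelDiagram a ha).Chain (i - 1) j),
      (pretzelDiagram a ha).differential num (i - 1) i j w = 2 • z.1 ∧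
      (pretzelDiagram a ha).oneMinus i j (initialState a T) z.1 ≠ 0 ∧
      ∀ T', (∀ l, T' l ≤ (a l).natAbs) → T' ≠ T →
        (pretzelDiagram a ha).oneMinus i j (initialState a T') z.1 = 0 := by
  classical
  obtain ⟨l₀, hl₀⟩ := hT.exists_lt
  have hpos : 0 < a l₀ := by
    rcases lt_or_gt_of_ne (ha l₀) with h | h
    · exact absurd (hT.neg l₀ h) hl₀.ne
    · exact h
  set p₀ : PretzelCrossing a × Corner := (top ha l₀, Corner.nw) with hp₀
  set z := countChain ha num i j {p₀} T with hz
  have hzapp : ∀ s, z s = if s.1.2 = (pretzelDiagram a ha).baseSigns {p₀} s.1.1 then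
      if HasCount s.1.1 T then sortSign Before num s.1.1 else 0 else 0 :=
    fun s => sectionChain_apply _ _ _ _ _ _
  have hdeg : ∀ S, HasCount S T →
      (pretzelDiagram a ha).homDegree ⟨S, (pretzelDiagram a ha).baseSigns {p₀} S⟩ = i ∧
      (pretzelDiagram a ha).quantumDegree ⟨S, (pretzelDiagram a ha).baseSigns {p₀} S⟩ = j :=
    fun S hS => ⟨(homDegree_eq ha hS _).trans hi.symm,
      (quantumDegree_baseSigns_singleton ha hneg hS hT.full p₀).trans hj.symm⟩
  -- If there is room for one more `B` in column `l`, then `T l` is not maximal, hence odd, and the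
  -- factor vanishes. `R` is kept general in order to serve both the cycle and, away from `l₀`, the
  -- chain bounding its double.
  have hodd : ∀ {S : PretzelCrossing a → Label} {R : Fin n → ℕ} {l : Fin n}, R l = T l →
      HasCount S (Function.update R l (R l + 1)) → (1 + (-1) ^ R l : ℤ) = 0 := by
    intro S R l hR hS
    have h1 := hS l
    rw [Function.update_self, hR] at h1
    have h2 := count_le S l
    rw [hR, (hT.odd l (by omega)).neg_one_pow]
    norm_num
  have hcycle : (pretzelDiagram a ha).differential num i (i + 1) j z = 0 := by
    ext t
    rw [hz, differential_countChain ha num hneg Set.subsingleton_singleton hT.full hdeg]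
    refine Finset.sum_eq_zero fun l _ => ?_
    split_ifs with h
    · rw [hodd rfl h]; ring
    · rfl
  -- One `B` is removed from column `l₀`. The count there becomes even, so its factor is 2, and it
  -- stays positive because `T l₀ ≥ 2`.
  set R : Fin n → ℕ := Function.update T l₀ (T l₀ - 1) with hR
  have hRl : R l₀ = T l₀ - 1 := Function.update_self ..
  have h2 := hT.two_le l₀ hpos
  have hRT : Function.update R l₀ (R l₀ + 1) = T := by
    funext l
    by_cases h : l = l₀
    · subst h; rw [Function.update_self, hRl]; omega
    · rw [Function.update_of_ne h, hR, Function.update_of_ne h]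
  have hRfull : Full a R :=
    { neg := fun l hl => by
        rw [hR, Function.update_of_ne (by rintro rfl; omega)]
        exact hT.neg l hl
      pos := fun l hl => by
        by_cases h : l = l₀
        · subst h; omega
        · rw [hR, Function.update_of_ne h]
          exact hT.full.pos l hl }
  have hRsum : ∑ l, (R l : ℤ) = i - 1 := by
    have h1 := Finset.sum_update_of_mem (Finset.mem_univ l₀) T (T l₀ - 1)
    have h3 := Finset.add_sum_erase Finset.univ T (Finset.mem_univ l₀)
    rw [Finset.sdiff_singleton_eq_erase] at h1
    have h4 : ∑ l, R l + 1 = ∑ l, T l := by rw [hR]; omega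
    rw [hi]
    have h5 : (∑ l, (R l : ℤ)) + 1 = ∑ l, (T l : ℤ) := by exact_mod_cast h4
    linarith
  have hRdeg : ∀ S, HasCount S R →
      (pretzelDiagram a ha).homDegree ⟨S, (pretzelDiagram a ha).baseSigns ∅ S⟩ = i - 1 ∧
      (pretzelDiagram a ha).quantumDegree ⟨S, (pretzelDiagram a ha).baseSigns ∅ S⟩ = j :=
    fun S hS => ⟨(homDegree_eq ha hS _).trans hRsum, by
      rw [quantumDegree_baseSigns_empty ha hneg hS hRfull, hRsum, hj, ← hi]; ring⟩
  -- The sign contributed by the columns before `l₀`; multiplying by it makes the boundary exactly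
  -- `2 • z`.
  set ε : ℤ := (-1) ^ ∑ l' with l' < l₀, R l' with hε
  have hεε : ε * ε = 1 := by rw [hε, ← pow_add, Even.neg_one_pow ⟨_, rfl⟩]
  have hboundary : (pretzelDiagram a ha).differential num (i - 1) i j
      (ε • countChain ha num (i - 1) j ∅ R) = 2 • z := by
    ext t
    rw [map_smul, Finsupp.smul_apply,
      differential_countChain ha num hneg Set.subsingleton_empty hRfull hRdeg,
      Finset.sum_eq_single l₀]
    · rw [hRT, Finsupp.smul_apply, hzapp]
      have hone : (-1 : ℤ) ^ R l₀ = 1 := by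
        rw [hRl]
        have := hT.odd l₀ hl₀
        exact (Nat.Odd.sub_odd this odd_one).neg_one_pow
      have hextra : (pretzelDiagram a ha).extraMinus ∅ t.1.2
          ((pretzelDiagram a ha).circleThrough t.1.1 p₀) =
          if t.1.2 = (pretzelDiagram a ha).baseSigns {p₀} t.1.1 then 1 else 0 := by
        rw [extraMinus_empty, baseSigns_singleton]
        split_ifs <;> rfl
      rw [hone, hextra]
      simp only [smul_eq_mul, nsmul_eq_mul]
      split_ifs
      · linear_combination (2 * sortSign Before num t.1.1) * hεε
      all_goals simp
    · intro l _ hl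
      split_ifs with h
      · rw [hodd (by rw [hR, Function.update_of_ne hl]) h]; ring
      · rfl
    · simp
  refine ⟨⟨z, hcycle⟩, _, hboundary, ?_, ?_⟩
  · have hc := hasCount_initialState hT.le
    -- Over `initialState a T` the cycle has a single term, with its minus sign on the circle
    -- through `p₀`. Its coefficient squares to 1, so it is nonzero modulo 2.
    rw [oneMinus_apply, Finset.sum_eq_single
      ⟨⟨initialState a T, (pretzelDiagram a ha).baseSigns {p₀} _⟩, hdeg _ hc⟩]
    · rw [hzapp, if_pos rfl, if_pos hc, if_pos ⟨_, congrArg (Sigma.mk _) (baseSigns_singleton ..)⟩, mul_one]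
      intro h
      have h3 := congrArg (Int.cast : ℤ → ZMod 2)
        (sortSign_mul_self Before num (initialState a T))
      push_cast at h3
      rw [h, zero_mul] at h3
      exact absurd h3 (by decide)
    · intro s _ hs
      rw [hzapp]
      split_ifs with h1 h3 h4
      · obtain ⟨C, hC⟩ := h4
        refine absurd (Subtype.ext ?_) hs
        obtain ⟨⟨S, τ⟩, hs'⟩ := s
        obtain rfl : S = initialState a T := congrArg Sigma.fst hC
        have h1' : τ = _ := h1
        exact congrArg (Sigma.mk _) h1'
      all_goals simp
    · simp
  · intro T' hT' hne
    rw [oneMinus_apply]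
    refine Finset.sum_eq_zero fun s _ => ?_
    rw [hzapp]
    split_ifs with h1 h3 h4
    · obtain ⟨C, hC⟩ := h4
      -- The cycle is supported on states with counts `T`, while `initialState a T'` has counts
      -- `T'`.
      rw [congrArg Sigma.fst hC] at h3
      exact absurd ((hasCount_initialState hT').unique h3) hne
    all_goals simp

/-- The subgroup generated by the torsion class for an admissible label count. -/
theorem exists_torsion_subgroup (hneg : ∃ j k, j ≠ k ∧ a j < 0 ∧ a k < 0) {T : Fin n → ℕ}
    (hT : Admissible a T) {i j : ℤ} (hi : i = ∑ l, (T l : ℤ))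
    (hj : j = 2 * ∑ l, (T l : ℤ) + excess ha - 2) :
    ∃ H : AddSubgroup ((pretzelDiagram a ha).DiagramHomology num i j),
      Nonempty (H ≃+ ZMod 2) ∧
      (pretzelDiagram a ha).Detects num (initialState a T) H ∧
      ∀ T', Admissible a T' → T' ≠ T →
        ¬ (pretzelDiagram a ha).Detects num (initialState a T') H := by
  obtain ⟨z, w, hw, hz, hz'⟩ := exists_torsion_cycle ha num hneg hT hi hj
  refine ⟨AddSubgroup.zmultiples ((pretzelDiagram a ha).homologyClass num i j z), ?_,
    ⟨z, AddSubgroup.mem_zmultiples _, hz⟩, ?_⟩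
  · refine nonempty_zmultiples_addEquiv
      ((pretzelDiagram a ha).two_nsmul_homologyClass num i j z w hw) fun h => hz ?_
    rw [← oneMinusHomology_class _ num i j (hT.separated ha hneg), h, map_zero]
  · rintro T' hT' hne ⟨z', hmem, hne'⟩
    apply hne'
    obtain ⟨m, hm⟩ := AddSubgroup.mem_zmultiples_iff.1 hmem
    rw [← oneMinusHomology_class _ num i j (hT'.separated ha hneg), ← hm, map_zsmul,
      oneMinusHomology_class, hz' T' hT'.le hne, smul_zero]

/-! ### Counting the admissible label counts -/

open Classical in
/-- The label counts in the column of an entry `m`. -/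
noncomputable def columnCounts (m : ℤ) : Finset ℕ :=
  if 0 < m then (Finset.Icc 1 (m.toNat / 2)).image fun r => min (2 * r + 1) m.natAbs
  else {m.natAbs}

theorem card_columnCounts (m : ℤ) :
    (columnCounts m).card = if 0 < m then m.toNat / 2 else 1 := by
  unfold columnCounts
  split_ifs with h
  · rw [Finset.card_image_of_injOn, Nat.card_Icc, Nat.add_sub_cancel]
    -- The minimum takes effect only for `m` even and `r = m / 2`, where the value `m` is even; all
    -- other values are distinct odd numbers.
    intro r hr r' hr' heq
    simp only [Finset.coe_Icc, Set.mem_Icc] at hr hr'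
    simp only at heq
    omega
  · simp

/-- The admissible label counts. -/
noncomputable def admissibleCounts (a : Fin n → ℤ) : Finset (Fin n → ℕ) :=
  (Fintype.piFinset fun l => columnCounts (a l)).erase fun l => (a l).natAbs

theorem le_card_admissibleCounts (a : Fin n → ℤ) :
    (∏ l with 0 < a l, (a l).toNat / 2) - 1 ≤ (admissibleCounts a).card := by
  refine le_trans (le_of_eq ?_) Finset.pred_card_le_card_erase
  rw [Fintype.card_piFinset, Finset.prod_filter]
  simp only [card_columnCounts]

theorem admissible_of_mem (ha : ∀ l, a l ≠ 0) (hone : ∀ l, a l ≠ 1) {T : Fin n → ℕ}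
    (hT : T ∈ admissibleCounts a) : Admissible a T := by
  obtain ⟨hne, hmem⟩ := Finset.mem_erase.1 hT
  rw [Fintype.mem_piFinset] at hmem
  have hneg : ∀ l, a l < 0 → T l = (a l).natAbs := by
    intro l hl
    have := hmem l
    rw [columnCounts, if_neg hl.not_gt, Finset.mem_singleton] at this
    exact this
  have hpos : ∀ l, 0 < a l → ∃ r, 1 ≤ r ∧ min (2 * r + 1) (a l).natAbs = T l := by
    intro l hl
    have := hmem l
    rw [columnCounts, if_pos hl, Finset.mem_image] at this
    obtain ⟨r, hr, h⟩ := this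
    exact ⟨r, (Finset.mem_Icc.1 hr).1, h⟩
  have hle : ∀ l, T l ≤ (a l).natAbs := by
    intro l
    rcases lt_or_gt_of_ne (ha l) with hl | hl
    · exact (hneg l hl).le
    · obtain ⟨r, -, h⟩ := hpos l hl
      omega
  refine ⟨hneg, fun l hl => ?_, hle, fun l hl => ?_, ?_⟩
  -- Here `2 * r + 1 ≥ 3`, and a positive entry different from 1 is at least 2.
  · obtain ⟨r, hr, h⟩ := hpos l hl
    have := hone l
    omega
  · rcases lt_or_gt_of_ne (ha l) with hl' | hl'
    · exact absurd (hneg l hl') hl.ne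
    · obtain ⟨r, hr, h⟩ := hpos l hl'
      exact ⟨r, by omega⟩
  -- If no column had an `A` left, `T` would be the erased function.
  · by_contra hcon
    push Not at hcon
    exact hne (funext fun l => le_antisymm (hle l) (hcon l))

theorem exists_torsion_subgroup_khovanovHomology (hneg : ∃ j k, j ≠ k ∧ a j < 0 ∧ a k < 0)
    (o : (pretzelDiagram a ha).Orientation) {T : Fin n → ℕ} (hT : Admissible a T) :
    ∃ (h q : ℤ) (H : AddSubgroup ((pretzelDiagram a ha).KhovanovHomology num o h q)),
      Nonempty (H ≃+ ZMod 2) ∧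
      (pretzelDiagram a ha).Detects num (initialState a T) H ∧
      ∀ T', Admissible a T' → T' ≠ T →
        ¬ (pretzelDiagram a ha).Detects num (initialState a T') H :=
  -- These degrees undo the shift by the numbers of positive and negative crossings.
  ⟨∑ l, (T l : ℤ) - o.negativeCount,
    2 * ∑ l, (T l : ℤ) + excess ha - 2 - 2 * o.negativeCount + o.positiveCount,
    exists_torsion_subgroup ha num hneg hT (by ring) (by ring)⟩

end PretzelCrossing

/-! ### Counting the subgroups -/

/-- A family of elements of a set that are told apart by predicates. -/
theorem Finset.card_le_encard_of_distinguished {α β : Type*} [Nonempty β] (A : Finset α)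
    (B : Set β) (P : α → β → Prop)
    (h : ∀ x ∈ A, ∃ y ∈ B, P x y ∧ ∀ x' ∈ A, x' ≠ x → ¬ P x' y) : (A.card : ℕ∞) ≤ B.encard := by
  choose! f hfB hfP hfne using h
  have hinj : Set.InjOn f (A : Set α) := by
    intro x hx x' hx' heq
    by_contra hne
    exact hfne x hx x' hx' (Ne.symm hne) (heq ▸ hfP x' hx')
  rw [← Set.encard_coe_eq_coe_finsetCard, ← hinj.encard_image]
  refine Set.encard_le_encard ?_
  rintro _ ⟨x, hx, rfl⟩
  exact hfB x hx

/-- `Detects` makes sense in every bidegree at once, so it tells the triples apart without a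
comparison of their degrees. -/
theorem LinkDiagram.card_le_encard_of_detects {X α : Type} [Fintype X] (D : LinkDiagram X)
    (num : X ↪ ℕ) (o : D.Orientation) (A : Finset α) (S : α → X → Label)
    (hA : ∀ x ∈ A, ∃ (h q : ℤ) (H : AddSubgroup (D.KhovanovHomology num o h q)),
      Nonempty (H ≃+ ZMod 2) ∧ D.Detects num (S x) H ∧
      ∀ x' ∈ A, x' ≠ x → ¬ D.Detects num (S x') H) :
    (A.card : ℕ∞) ≤
      Set.encard {T : Σ h : ℤ, Σ q : ℤ, AddSubgroup (D.KhovanovHomology num o h q) |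
        Nonempty (T.2.2 ≃+ ZMod 2)} := by
  have : Nonempty (Σ h : ℤ, Σ q : ℤ, AddSubgroup (D.KhovanovHomology num o h q)) := ⟨⟨0, 0, ⊥⟩⟩
  refine Finset.card_le_encard_of_distinguished _ _
      (fun x y => D.Detects num (S x) y.2.2) fun x hx => ?_
  exact (hA x hx).elim fun h hA => hA.elim fun q hA => hA.elim fun H hA =>
    ⟨⟨h, q, H⟩, hA.1, hA.2.1, hA.2.2⟩

theorem corollary8p1 {n : ℕ} (a : Fin n → ℤ) (ha : ∀ l, a l ≠ 0)
    (hone : ∀ l, a l ≠ 1)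
    (hthree : ∃ i, 3 ≤ a i)
    (hneg : ∃ j k, j ≠ k ∧ a j < 0 ∧ a k < 0)
    (num : PretzelCrossing a ↪ ℕ)
    (o : (pretzelDiagram a ha).Orientation) :
    (((∏ l with 0 < a l, (a l).toNat / 2) - 1 : ℕ) : ℕ∞) ≤
      Set.encard {T : Σ h : ℤ, Σ q : ℤ,
          AddSubgroup ((pretzelDiagram a ha).KhovanovHomology num o h q) |
        Nonempty (T.2.2 ≃+ ZMod 2)} := by
  refine le_trans (Nat.cast_le.2 (PretzelCrossing.le_card_admissibleCounts a))
    ((pretzelDiagram a ha).card_le_encard_of_detects num o _ (PretzelCrossing.initialState a)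
      fun T hT => ?_)
  exact (PretzelCrossing.exists_torsion_subgroup_khovanovHomology ha num hneg o
    (PretzelCrossing.admissible_of_mem ha hone hT)).imp fun h hE => hE.imp fun q hE =>
    hE.imp fun H hE => ⟨hE.1, hE.2.1, fun T' hT' =>
      hE.2.2 T' (PretzelCrossing.admissible_of_mem ha hone hT')⟩
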